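/- Let $\kappa>0$ and $l\in\mathbb C$, put $p(\zeta)=\kappa|\zeta|^2+\mathrm{Re}(l\zeta^2)$ for $\zeta\in\mathbb C$, and let $$\mathcal D_{\kappa,l}=\{(z_1,z_2)\in\mathbb C^2:\ \mathrm{Im}\,z_2>p(z_1)\}.$$ For $\tau>0$ let $H_{\tau,\kappa,l}$ be the space of entire functions $f:\mathbb C\to\mathbb C$ with $\int_{\mathbb C}|f|^2e^{-4\pi\tau p}\,d\lambda<\infty$ ($\lambda$ Lebesgue measure), with inner product $\int_{\mathbb C} f\bar g\,e^{-4\pi\tau p}\,d\lambda$, and let $K_{\tau,\kappa,l}$ be its Bergman kernel, i.e. its reproducing kernel. Let $H^2(\mathcal D_{\kappa,l})$ be the Hardy space of holomorphic functions $F$ on $\mathcal D_{\kappa,l}$ with $$\sup_{\varepsilon>0}\int_{\mathbb C}\int_{\mathbb R}|F(\zeta,t+ip(\zeta)+i\varepsilon)|^2\,dt\,d\lambda(\zeta)<\infty,$$ with the inner product in $L^2(\mathbb C\times\mathbb R,\,d\lambda\,dt)$ of the boundary values (the $L^2$-limits as $\varepsilon\to0^+$ of the functions $(\zeta,t)\mapsto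 F(\zeta,t+ip(\zeta)+i\varepsilon)$), and let $S$ be the Szegő kernel of $\mathcal D_{\kappa,l}$, i.e. the reproducing kernel of $H^2(\mathcal D_{\kappa,l})$. Then these boundary values and both kernels exist, the kernels are unique, $$K_{\tau,\kappa,l}(\zeta,\omega)=4\tau\kappa\,\exp\!\big(2\pi\tau(l\zeta^2+\bar l\,\bar\omega^2)+4\pi\tau\kappa\,\zeta\bar\omega\big)\qquad(\tau>0,\ \zeta,\omega\in\mathbb C),$$ and for all $(z',z),(w',w)\in\mathcal D_{\kappa,l}$ $$S((z',z),(w',w))=\int_0^\infty K_{\tau,\kappa,l}(z',w')\,e^{-2\pi i\tau(\bar w-z)}\,d\tau =\frac{\kappa}{\pi^2}\Big(i(\bar w-z)-2\kappa z'\bar w'-\big(l z'^2+\bar l\,\bar w'^2\big)\Big)^{-2},$$ where the integral converges absolutely. (Replacing $l$ by $-l$: for the domain $\{\mathrm{Im}\,z_2>\kappa|z_1|^2-\mathrm{Re}(l z_1^2)\}$ the last term in the bracket is $+(l z'^2+\bar l\,\bar w'^2)$.) -/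

import Mathlib

open MeasureTheory Filter Topology
open scoped ComplexConjugate ENNReal Real

namespace SzegoBergman

/-! ### Weighted spaces of entire functions of one variable -/

/-- The space `A²(ℂ, e^{-φ})` of entire functions `f` with `∫ |f|² e^{-φ} dλ < ∞`. -/
def weightedSpace (φ : ℂ → ℝ) : Set (ℂ → ℂ) :=
  {f | Differentiable ℂ f ∧ Integrable (fun z : ℂ => ‖f z‖ ^ 2 * Real.exp (-φ z)) volume}

/-- `K` is the Bergman kernel of `A²(ℂ, e^{-φ})`: for each `w` the function `K(·, w)` belongs to the
space and represents the evaluation at `w` with respect to the inner product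
`⟨f, g⟩ = ∫ f ḡ e^{-φ} dλ`. -/
structure IsBergmanKernel (φ : ℂ → ℝ) (K : ℂ → ℂ → ℂ) : Prop where
  mem : ∀ w : ℂ, (fun z => K z w) ∈ weightedSpace φ
  reproducing : ∀ f ∈ weightedSpace φ, ∀ w : ℂ,
    f w = ∫ z : ℂ, f z * conj (K z w) * (Real.exp (-φ z) : ℂ)

/-! ### Hardy spaces and Szegő kernels of the domains `{Im z₂ > p(z₁)}` in `ℂ²`

The boundary is parametrised by `ℂ × ℝ` through `(ζ, t) ↦ (ζ, t + i p(ζ))` and carries the measure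
`dλ(ζ) dt`. The function `p` is meant to be continuous. -/

/-- The domain `{(z₁, z₂) ∈ ℂ² : Im z₂ > p(z₁)}`. -/
def domainAbove (p : ℂ → ℝ) : Set (ℂ × ℂ) :=
  {z | p z.1 < z.2.im}

/-- The restriction of `F` to the boundary translated by `ε` in the direction `Im z₂`:
`(ζ, t) ↦ F(ζ, t + i p(ζ) + i ε)`. -/
noncomputable def slice (p : ℂ → ℝ) (F : ℂ × ℂ → ℂ) (ε : ℝ) : ℂ × ℝ → ℂ :=
  fun q => F (q.1, (q.2 : ℂ) + Complex.I * (p q.1 : ℂ) + Complex.I * (ε : ℂ))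

/-- The Hardy space `H²`: functions `F` holomorphic in `{Im z₂ > p(z₁)}` with
`sup_{ε > 0} ∫_ℂ ∫_ℝ |F(ζ, t + i p(ζ) + i ε)|² dt dλ(ζ) < ∞`. -/
def hardySpace (p : ℂ → ℝ) : Set (ℂ × ℂ → ℂ) :=
  {F | DifferentiableOn ℂ F (domainAbove p) ∧
    (⨆ ε : Set.Ioi (0 : ℝ), ∫⁻ q : ℂ × ℝ, ‖slice p F ε q‖ₑ ^ 2) < ∞}

/-- `f ∈ L²(ℂ × ℝ)` is the boundary value of `F`: the slices of `F` tend to `f` in `L²`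
as `ε → 0+`. -/
def IsBoundaryValue (p : ℂ → ℝ) (F : ℂ × ℂ → ℂ) (f : ℂ × ℝ → ℂ) : Prop :=
  MemLp f 2 volume ∧
    Tendsto (fun ε : ℝ => eLpNorm (fun q => slice p F ε q - f q) 2 volume) (𝓝[>] 0) (𝓝 0)

/-- `S` is the Szegő kernel of `{Im z₂ > p(z₁)}`: for each `w` in the domain, `S(·, w)` belongs to
the Hardy space and represents the evaluation at `w` with respect to the inner product of boundary
values in `L²(dλ dt)` (every element of the Hardy space having such a boundary value). -/
def IsSzegoKernel (p : ℂ → ℝ) (S : ℂ × ℂ → ℂ × ℂ → ℂ) : Prop :=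
  ∀ w ∈ domainAbove p, (fun z => S z w) ∈ hardySpace p ∧
    ∃ s : ℂ × ℝ → ℂ, IsBoundaryValue p (fun z => S z w) s ∧
      ∀ F ∈ hardySpace p, ∃ f : ℂ × ℝ → ℂ, IsBoundaryValue p F f ∧
        F w = ∫ q : ℂ × ℝ, f q * conj (s q)

/-! ### The quadratic model -/

/-- The function `κ|ζ|² + Re(l ζ²)`. -/
noncomputable def quad (κ : ℝ) (l : ℂ) (ζ : ℂ) : ℝ :=
  κ * ‖ζ‖ ^ 2 + (l * ζ ^ 2).re

/-- The domain `D_{κ,l} = {Im z₂ > κ|z₁|² + Re(l z₁²)}`. -/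
noncomputable def modelDomain (κ : ℝ) (l : ℂ) : Set (ℂ × ℂ) :=
  domainAbove (quad κ l)

/-- The weight exponent `4πτ(κ|ζ|² + Re(l ζ²))` of the space `H_{τ,κ,l}`. -/
noncomputable def modelWeight (τ κ : ℝ) (l : ℂ) (ζ : ℂ) : ℝ :=
  4 * π * τ * quad κ l ζ

end SzegoBergman

/-!
Against the weight, the conjugate of the proposed Bergman kernel at `w` is an entire function times
a Gaussian in `|ζ - w|`, so reproduction at `w` follows from the mean value property on the circles
around `w`.

For the Hardy space, fix `w = (a, b)`. As a function of `t`, the conjugate of the proposed Szegő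
kernel at `(ζ, t + i p(ζ))` has a double pole in the upper half-plane, so Cauchy's formula turns the
`t`-integral of a slice of `F` against it into `∂F/∂z₂` at a point `(ζ, b + i h(ζ))`. On the circle
of radius `r` around `a`, the height `h` agrees with a function holomorphic in `ζ`, whose value at
`a` is `2 κ r²`. The average over the circle is `∂F/∂z₂ (a, b + 2 i κ r²)`, and integrating
over `r` in polar coordinates is the fundamental theorem of calculus, the contribution at infinity
vanishing because `F` decays in the direction `Im z₂ → ∞`.

Boundary values exist since the inner product of the slices at heights `α` and `β` depends only on
`α + β`; this makes the slices Cauchy as soon as their norms converge. Finally, the formula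
`∫ τ e^{-cτ} dτ = c⁻²` turns the integral of the Bergman kernels into the Szegő kernel.
-/

namespace SzegoBergman

/-! ### Polar coordinates and area mean values -/

section PolarCoordinates

variable {E : Type*} [NormedAddCommGroup E] [NormedSpace ℝ E] {Φ : ℂ → E}

theorem integrableOn_polarCoord_target_smul (hΦ : Integrable Φ) :
    IntegrableOn (fun p : ℝ × ℝ ↦ p.1 • Φ (Complex.polarCoord.symm p)) polarCoord.target := by
  have hreal : Integrable (Φ ∘ Complex.measurableEquivRealProd.symm) :=
    (Complex.volume_preserving_equiv_real_prod.symm).integrable_comp_of_integrable hΦ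
  have himage : IntegrableOn (Φ ∘ Complex.measurableEquivRealProd.symm)
      (polarCoord.symm '' polarCoord.target) := hreal.integrableOn
  rw [integrableOn_image_iff_integrableOn_abs_det_fderiv_smul volume
    polarCoord.open_target.measurableSet
    (fun p _ ↦ (hasFDerivAt_polarCoord_symm p).hasFDerivWithinAt) polarCoord.symm.injOn] at himage
  refine himage.congr_fun (fun p hp ↦ ?_) polarCoord.open_target.measurableSet
  have hp : 0 < p.1 := hp.1
  simp only [det_fderivPolarCoordSymm, abs_of_pos hp, Function.comp,
    Complex.measurableEquivRealProd_symm_polarCoord_symm_apply]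

theorem integral_Ioo_polarCoord_symm_add (Φ : ℂ → E) (w : ℂ) (r : ℝ) :
    ∫ θ in Set.Ioo (-π) π, Φ (Complex.polarCoord.symm (r, θ) + w)
      = (2 * π) • Real.circleAverage Φ w r := by
  have hcircle : ∀ θ : ℝ, Complex.polarCoord.symm (r, θ) + w = circleMap w r θ := fun θ ↦ by
    simp only [Complex.polarCoord_symm_apply, circleMap, Complex.exp_mul_I]
    push_cast
    rw [add_comm]
  simp only [hcircle]
  rw [Real.circleAverage_eq_integral_add (-π), smul_inv_smul₀ (by positivity),
    intervalIntegral.integral_comp_add_right (fun θ ↦ Φ (circleMap w r θ)),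
    show 0 + -π = -π by ring, show 2 * π + -π = π by ring,
    intervalIntegral.integral_of_le (by linarith [Real.pi_pos]), integral_Ioc_eq_integral_Ioo]

theorem integrableOn_smul_circleAverage (hΦ : Integrable Φ) (w : ℂ) :
    IntegrableOn (fun r : ℝ ↦ r • Real.circleAverage Φ w r) (Set.Ioi 0) := by
  have hpolar := integrableOn_polarCoord_target_smul (hΦ.comp_add_right w)
  rw [IntegrableOn, polarCoord_target, Measure.volume_eq_prod, ← Measure.prod_restrict] at hpolar
  have hradial := hpolar.integral_prod_left
  simp only [integral_smul, integral_Ioo_polarCoord_symm_add] at hradial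
  refine (hradial.smul (2 * π)⁻¹).congr (Eventually.of_forall fun r ↦ ?_)
  simp only [Pi.smul_apply]
  rw [smul_comm, inv_smul_smul₀ (by positivity)]

theorem integral_eq_integral_smul_circleAverage (hΦ : Integrable Φ) (w : ℂ) :
    ∫ z, Φ z = (2 * π) • ∫ r in Set.Ioi (0 : ℝ), r • Real.circleAverage Φ w r := by
  have hpolar := integrableOn_polarCoord_target_smul (hΦ.comp_add_right w)
  rw [IntegrableOn, polarCoord_target, Measure.volume_eq_prod, ← Measure.prod_restrict] at hpolar
  rw [← integral_add_right_eq_self Φ w, ← Complex.integral_comp_polarCoord_symm, polarCoord_target,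
    Measure.volume_eq_prod, ← Measure.prod_restrict, integral_prod _ hpolar]
  simp only [integral_smul, integral_Ioo_polarCoord_symm_add]
  simp only [smul_comm _ (2 * π), integral_smul]

end PolarCoordinates

section MeanValue

variable {E : Type*} [NormedAddCommGroup E] [NormedSpace ℂ E] [CompleteSpace E]
  {g : ℂ → E} {c : ℂ} {r σ : ℝ}

theorem circleAverage_eq_of_differentiableOn (hg : DifferentiableOn ℂ g (Metric.closedBall c r))
    (hr : 0 ≤ r) : Real.circleAverage g c r = g c := by
  refine DiffContOnCl.circleAverage (DifferentiableOn.diffContOnCl (hg.mono ?_))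
  rw [abs_of_nonneg hr]
  exact Metric.closure_ball_subset_closedBall

theorem smul_circleAverage_indicator_ball (hg : DifferentiableOn ℂ g (Metric.closedBall c σ))
    (hr : 0 ≤ r) : r • Real.circleAverage ((Metric.ball c σ).indicator g) c r
      = (Set.Iio σ).indicator (fun r : ℝ ↦ r • g c) r := by
  rcases lt_or_ge r σ with h | h
  · rw [Set.indicator_of_mem (Set.mem_Iio.2 h), ← circleAverage_eq_of_differentiableOn
      (hg.mono (Metric.closedBall_subset_closedBall h.le)) hr]
    congr 1
    refine Real.circleAverage_congr_sphere fun z hz ↦ Set.indicator_of_mem ?_ g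
    rw [abs_of_nonneg hr] at hz
    exact Metric.mem_ball.2 (hz.trans_lt h)
  · rw [Set.indicator_of_notMem (Set.notMem_Iio.2 h), ← smul_zero r,
      ← Real.circleAverage_const (0 : E) c r]
    congr 1
    refine Real.circleAverage_congr_sphere fun z hz ↦ Set.indicator_of_notMem ?_ g
    rw [abs_of_nonneg hr] at hz
    exact fun hz' ↦ (hz.trans_ge h).not_gt (Metric.mem_ball.1 hz')

theorem integral_ball_of_differentiableOn (hσ : 0 ≤ σ)
    (hg : DifferentiableOn ℂ g (Metric.closedBall c σ)) :
    ∫ z in Metric.ball c σ, g z = (π * σ ^ 2) • g c := by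
  have hint : Integrable ((Metric.ball c σ).indicator g) :=
    ((hg.continuousOn.integrableOn_compact (isCompact_closedBall c σ)).mono_set
      Metric.ball_subset_closedBall).integrable_indicator measurableSet_ball
  rw [← integral_indicator measurableSet_ball, integral_eq_integral_smul_circleAverage hint c,
    setIntegral_congr_fun measurableSet_Ioi
      fun r hr ↦ smul_circleAverage_indicator_ball hg (le_of_lt hr),
    setIntegral_indicator measurableSet_Iio, Set.Ioi_inter_Iio, integral_smul_const,
    ← integral_Ioc_eq_integral_Ioo, ← intervalIntegral.integral_of_le hσ, integral_id, smul_smul]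
  ring_nf

end MeanValue

theorem sq_enorm_le_lintegral_ball {g : ℂ → ℂ} {c : ℂ} {σ : ℝ} (hσ : 0 ≤ σ)
    (hg : DifferentiableOn ℂ g (Metric.closedBall c σ)) :
    ENNReal.ofReal (π * σ ^ 2) * ‖g c‖ₑ ^ 2 ≤ ∫⁻ z in Metric.ball c σ, ‖g z‖ₑ ^ 2 := by
  have hle := enorm_integral_le_lintegral_enorm
    (μ := volume.restrict (Metric.ball c σ)) (g ^ 2)
  rw [integral_ball_of_differentiableOn hσ (hg.pow 2), enorm_smul,
    Real.enorm_of_nonneg (by positivity)] at hle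
  simpa only [Pi.pow_apply, enorm_pow] using hle

theorem sq_enorm_le_lintegral_bidisc {F : ℂ × ℂ → ℂ} {a b : ℂ} {ρ σ : ℝ} (hρ : 0 ≤ ρ) (hσ : 0 ≤ σ)
    (hF : DifferentiableOn ℂ F (Metric.closedBall a ρ ×ˢ Metric.closedBall b σ)) :
    ENNReal.ofReal (π * ρ ^ 2) * ENNReal.ofReal (π * σ ^ 2) * ‖F (a, b)‖ₑ ^ 2
      ≤ ∫⁻ z in Metric.ball a ρ ×ˢ Metric.ball b σ, ‖F z‖ₑ ^ 2 := by
  have hfst : DifferentiableOn ℂ (fun z ↦ F (z, b)) (Metric.closedBall a ρ) :=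
    hF.comp (by fun_prop) fun z hz ↦ ⟨hz, Metric.mem_closedBall_self hσ⟩
  have hsnd : ∀ z ∈ Metric.ball a ρ,
      DifferentiableOn ℂ (fun u ↦ F (z, u)) (Metric.closedBall b σ) := fun z hz ↦
    hF.comp (by fun_prop) fun u hu ↦ ⟨Metric.ball_subset_closedBall hz, hu⟩
  have hmeas : AEMeasurable (fun z ↦ ‖F z‖ₑ ^ 2)
      (volume.restrict (Metric.ball a ρ ×ˢ Metric.ball b σ)) :=
    ((hF.continuousOn.mono (Set.prod_mono Metric.ball_subset_closedBall
      Metric.ball_subset_closedBall)).aemeasurable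
        (measurableSet_ball.prod measurableSet_ball)).enorm.pow_const 2
  rw [Measure.volume_eq_prod, ← Measure.prod_restrict] at hmeas ⊢
  rw [lintegral_prod _ hmeas, mul_right_comm, mul_comm]
  calc ENNReal.ofReal (π * σ ^ 2) * (ENNReal.ofReal (π * ρ ^ 2) * ‖F (a, b)‖ₑ ^ 2)
      ≤ ENNReal.ofReal (π * σ ^ 2) * ∫⁻ z in Metric.ball a ρ, ‖F (z, b)‖ₑ ^ 2 := by
        gcongr
        exact sq_enorm_le_lintegral_ball hρ hfst
    _ = ∫⁻ z in Metric.ball a ρ, ENNReal.ofReal (π * σ ^ 2) * ‖F (z, b)‖ₑ ^ 2 :=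
        (lintegral_const_mul' _ _ ENNReal.ofReal_ne_top).symm
    _ ≤ ∫⁻ z in Metric.ball a ρ, ∫⁻ u in Metric.ball b σ, ‖F (z, u)‖ₑ ^ 2 :=
        setLIntegral_mono_ae' measurableSet_ball
          (Eventually.of_forall fun z hz ↦ sq_enorm_le_lintegral_ball hσ (hsnd z hz))

/-! ### Bergman kernels -/

theorem integral_entire_mul_gaussian {α : ℝ} (hα : 0 < α) {g : ℂ → ℂ} (hg : Differentiable ℂ g)
    (hint : Integrable (fun z : ℂ ↦ g z * (Real.exp (-α * ‖z‖ ^ 2) : ℂ))) :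
    ∫ z : ℂ, g z * (Real.exp (-α * ‖z‖ ^ 2) : ℂ) = π / α * g 0 := by
  have hcircle : ∀ r ∈ Set.Ioi (0 : ℝ),
      r • Real.circleAverage (fun z ↦ g z * (Real.exp (-α * ‖z‖ ^ 2) : ℂ)) 0 r
        = (r : ℂ) * Complex.exp (-α * r ^ 2) * g 0 := fun r hr ↦ by
    have hsphere : Real.circleAverage (fun z ↦ g z * (Real.exp (-α * ‖z‖ ^ 2) : ℂ)) 0 r
        = Real.circleAverage (fun z ↦ g z * (Real.exp (-α * r ^ 2) : ℂ)) 0 r :=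
      Real.circleAverage_congr_sphere fun z hz ↦ by
        rw [abs_of_pos hr, mem_sphere_zero_iff_norm] at hz
        simp only [hz]
    rw [hsphere, circleAverage_eq_of_differentiableOn (by fun_prop) (le_of_lt hr),
      Complex.real_smul]
    push_cast
    ring
  rw [integral_eq_integral_smul_circleAverage hint 0,
    setIntegral_congr_fun measurableSet_Ioi hcircle, integral_mul_const,
    integral_mul_cexp_neg_mul_sq (by simpa using hα), Complex.real_smul]
  push_cast
  field_simp

theorem integrable_mul_conj_of_mem_weightedSpace {φ : ℂ → ℝ} (hφ : Measurable φ) {f g : ℂ → ℂ}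
    (hf : f ∈ weightedSpace φ) (hg : g ∈ weightedSpace φ) :
    Integrable (fun z : ℂ ↦ f z * conj (g z) * (Real.exp (-φ z) : ℂ)) := by
  have hfm := hf.1.continuous.measurable
  have hgm := hg.1.continuous.measurable
  refine (hf.2.add hg.2).mono' (by fun_prop) (Eventually.of_forall fun z ↦ ?_)
  simp only [norm_mul, RCLike.norm_conj, Complex.norm_real, Pi.add_apply,
    Real.norm_of_nonneg (Real.exp_pos _).le, ← add_mul]
  gcongr
  nlinarith [sq_nonneg (‖f z‖ - ‖g z‖), sq_nonneg ‖f z‖, sq_nonneg ‖g z‖]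

namespace IsBergmanKernel

variable {φ : ℂ → ℝ} {K K' : ℂ → ℂ → ℂ}

theorem apply_eq_conj (hK : IsBergmanKernel φ K) (hK' : IsBergmanKernel φ K') (z w : ℂ) :
    K z w = conj (K' w z) := by
  rw [hK'.reproducing _ (hK.mem w) z, hK.reproducing _ (hK'.mem z) w, ← integral_conj]
  congr 1 with u
  simp only [map_mul, Complex.conj_conj, Complex.conj_ofReal, mul_comm (K u w)]

theorem unique (hK : IsBergmanKernel φ K) (hK' : IsBergmanKernel φ K') : K = K' := by
  ext z w
  rw [hK.apply_eq_conj hK', ← hK'.apply_eq_conj hK']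

end IsBergmanKernel

/-- The closed form of the Bergman kernel of the weight `e^{-4πτp}`, `p = κ|ζ|² + Re(lζ²)`. -/
noncomputable def modelBergman (κ : ℝ) (l : ℂ) (τ : ℝ) (z w : ℂ) : ℂ :=
  4 * τ * κ * Complex.exp
    (2 * π * τ * (l * z ^ 2 + conj l * conj w ^ 2) + 4 * π * τ * κ * z * conj w)

section ModelBergman

variable (κ : ℝ) (l : ℂ) (τ : ℝ) (z w : ℂ)

theorem continuous_quad : Continuous (quad κ l) := by
  unfold quad
  fun_prop

theorem continuous_modelWeight : Continuous (modelWeight τ κ l) :=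
  (continuous_quad κ l).const_mul _

theorem ofReal_quad :
    (quad κ l z : ℂ) = κ * (z * conj z) + (l * z ^ 2 + conj l * conj z ^ 2) / 2 := by
  rw [quad, Complex.ofReal_add, Complex.re_eq_add_conj, Complex.mul_conj, Complex.normSq_eq_norm_sq]
  simp

theorem norm_modelBergman_sq_mul_exp_neg_modelWeight :
    ‖modelBergman κ l τ z w‖ ^ 2 * Real.exp (-modelWeight τ κ l z) =
      (4 * τ * κ) ^ 2 * Real.exp (modelWeight τ κ l w) *
        Real.exp (-(4 * π * τ * κ) * ‖z - w‖ ^ 2) := by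
  have hexponent : (2 * π * τ * (l * z ^ 2 + conj l * conj w ^ 2) + 4 * π * τ * κ * z * conj w).re
      = 2 * π * τ * ((l * z ^ 2).re + (l * w ^ 2).re) + 4 * π * τ * κ * (z * conj w).re := by
    rw [← Complex.conj_re (l * w ^ 2), map_mul, map_pow, ← Complex.add_re, ← Complex.re_ofReal_mul,
      ← Complex.re_ofReal_mul, ← Complex.add_re]
    push_cast
    ring_nf
  have hconst : ‖(4 * τ * κ : ℂ)‖ ^ 2 = (4 * τ * κ) ^ 2 := by
    rw [show (4 * τ * κ : ℂ) = ((4 * τ * κ : ℝ) : ℂ) by push_cast; ring, Complex.norm_real,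
      Real.norm_eq_abs, sq_abs]
  rw [modelBergman, norm_mul, mul_pow, hconst, Complex.norm_exp, hexponent, ← Real.exp_nat_mul,
    mul_assoc ((4 * τ * κ) ^ 2), mul_assoc ((4 * τ * κ) ^ 2), ← Real.exp_add,
    ← Real.exp_add, ← Complex.normSq_eq_norm_sq (z - w),
    Complex.normSq_sub, Complex.normSq_eq_norm_sq, Complex.normSq_eq_norm_sq, modelWeight,
    modelWeight, quad, quad]
  congr 2
  push_cast
  ring

theorem conj_modelBergman_mul_exp_neg_modelWeight :
    conj (modelBergman κ l τ z w) * (Real.exp (-modelWeight τ κ l z) : ℂ) =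
      4 * τ * κ * Complex.exp
        (2 * π * τ * l * (w ^ 2 - z ^ 2) - 4 * π * τ * κ * conj w * (z - w)) *
        (Real.exp (-(4 * π * τ * κ) * ‖z - w‖ ^ 2) : ℂ) := by
  have hnorm : ((‖z - w‖ : ℂ) ^ 2) = (z - w) * conj (z - w) := by
    rw [Complex.mul_conj, Complex.normSq_eq_norm_sq, Complex.ofReal_pow]
  simp only [modelBergman, modelWeight, map_mul, map_add, map_pow, Complex.conj_conj,
    ← Complex.exp_conj, Complex.conj_ofReal, map_ofNat, Complex.ofReal_exp]
  rw [mul_assoc (4 * τ * κ : ℂ), mul_assoc (4 * τ * κ : ℂ), ← Complex.exp_add, ← Complex.exp_add]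
  push_cast
  rw [hnorm, ofReal_quad, map_sub]
  ring_nf

end ModelBergman

theorem integrable_exp_neg_mul_norm_sq {b : ℝ} (hb : 0 < b) :
    Integrable (fun z : ℂ ↦ Real.exp (-b * ‖z‖ ^ 2)) := by
  have hgauss := GaussianFourier.integrable_cexp_neg_mul_sq_norm_add (V := ℂ) (b := (b : ℂ))
    (by simpa using hb) 0 0
  refine hgauss.norm.congr (Eventually.of_forall fun z ↦ ?_)
  simp [Complex.norm_exp, ← Complex.ofReal_pow]

section ModelBergmanKernel

variable {κ τ : ℝ}

theorem modelBergman_mem_weightedSpace (hκ : 0 < κ) (l : ℂ) (hτ : 0 < τ) (w : ℂ) :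
    (fun z ↦ modelBergman κ l τ z w) ∈ weightedSpace (modelWeight τ κ l) := by
  refine ⟨by unfold modelBergman; fun_prop, ?_⟩
  simp only [norm_modelBergman_sq_mul_exp_neg_modelWeight]
  exact ((integrable_exp_neg_mul_norm_sq (b := 4 * π * τ * κ) (by positivity)).comp_sub_right
    w).const_mul _

theorem isBergmanKernel_modelBergman (hκ : 0 < κ) (l : ℂ) (hτ : 0 < τ) :
    IsBergmanKernel (modelWeight τ κ l) (modelBergman κ l τ) := by
  refine ⟨modelBergman_mem_weightedSpace hκ l hτ, fun f hf w ↦ ?_⟩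
  let g : ℂ → ℂ := fun z ↦ f (z + w) * (4 * τ * κ * Complex.exp
    (2 * π * τ * l * (w ^ 2 - (z + w) ^ 2) - 4 * π * τ * κ * conj w * z))
  have hg : Differentiable ℂ g := by
    have := hf.1
    fun_prop
  have hshift : ∀ z : ℂ, f (z + w) * conj (modelBergman κ l τ (z + w) w) *
      (Real.exp (-modelWeight τ κ l (z + w)) : ℂ)
        = g z * (Real.exp (-(4 * π * τ * κ) * ‖z‖ ^ 2) : ℂ) := fun z ↦ by
    rw [mul_assoc, conj_modelBergman_mul_exp_neg_modelWeight, add_sub_cancel_right, ← mul_assoc]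
  have hint := (integrable_mul_conj_of_mem_weightedSpace (continuous_modelWeight κ l τ).measurable
    hf (modelBergman_mem_weightedSpace hκ l hτ w)).comp_add_right w
  simp only [hshift] at hint
  rw [← integral_add_right_eq_self _ w]
  simp only [hshift]
  rw [integral_entire_mul_gaussian (by positivity) hg hint]
  have hτ' : (τ : ℂ) ≠ 0 := Complex.ofReal_ne_zero.2 hτ.ne'
  have hκ' : (κ : ℂ) ≠ 0 := Complex.ofReal_ne_zero.2 hκ.ne'
  simp only [g, zero_add, sub_self, mul_zero, Complex.exp_zero, mul_one]
  push_cast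
  field_simp

end ModelBergmanKernel

/-! ### Contour integrals in strips and in the upper half plane -/

section ContourShift

variable {E : Type*} [NormedAddCommGroup E] [NormedSpace ℂ E] [CompleteSpace E]
  {h : ℂ → E} {a b : ℝ}

theorem hasDerivAt_integral_vertical (hab : a ≤ b)
    (hcont : ContinuousOn h (Complex.im ⁻¹' Set.Icc a b))
    (hdiff : DifferentiableOn ℂ h (Complex.im ⁻¹' Set.Ioo a b)) (x : ℝ) :
    HasDerivAt (fun x : ℝ ↦ ∫ y in a..b, h (x + y * Complex.I))
      (Complex.I • (h (x + a * Complex.I) - h (x + b * Complex.I))) x := by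
  have hedge : ∀ c ∈ Set.Icc a b, Continuous fun t : ℝ ↦ h (t + c * Complex.I) := fun c hc ↦
    hcont.comp_continuous (by fun_prop) fun t ↦ by simpa using hc
  have hbot := hedge a (Set.left_mem_Icc.2 hab)
  have htop := hedge b (Set.right_mem_Icc.2 hab)
  have hrect : ∀ x : ℝ, ∫ y in a..b, h (x + y * Complex.I) = Complex.I •
      (∫ t in (0 : ℝ)..x, (h (t + a * Complex.I) - h (t + b * Complex.I)))
        + ∫ y in a..b, h ((0 : ℝ) + y * Complex.I) := fun x ↦ by
    have hzero := Complex.integral_boundary_rect_eq_zero_of_continuousOn_of_differentiableOn h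
      (⟨0, a⟩ : ℂ) ⟨x, b⟩
      (hcont.mono fun z hz ↦ by simpa [Set.uIcc_of_le hab] using (Complex.mem_reProdIm.1 hz).2)
      (hdiff.mono fun z hz ↦ by simpa [hab] using (Complex.mem_reProdIm.1 hz).2)
    rw [intervalIntegral.integral_sub (hbot.intervalIntegrable _ _) (htop.intervalIntegrable _ _)]
    have hscaled := congrArg (Complex.I • ·) hzero
    simp only [smul_sub, smul_add, smul_smul, Complex.I_mul_I, neg_smul, one_smul,
      smul_zero] at hscaled ⊢
    rw [← sub_eq_zero, ← neg_eq_zero, ← hscaled]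
    abel
  rw [funext hrect]
  exact ((((hbot.sub htop).integral_hasStrictDerivAt 0 x).hasDerivAt).const_smul
    Complex.I).add_const _

theorem integral_horizontal_eq_of_integrable_strip (hab : a ≤ b)
    (hcont : ContinuousOn h (Complex.im ⁻¹' Set.Icc a b))
    (hdiff : DifferentiableOn ℂ h (Complex.im ⁻¹' Set.Ioo a b))
    (hstrip : Integrable (fun q : ℝ × ℝ ↦ h (q.1 + q.2 * Complex.I))
      (volume.prod (volume.restrict (Set.Ioc a b))))
    (hbot : Integrable fun x : ℝ ↦ h (x + a * Complex.I))
    (htop : Integrable fun x : ℝ ↦ h (x + b * Complex.I)) :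
    ∫ x : ℝ, h (x + a * Complex.I) = ∫ x : ℝ, h (x + b * Complex.I) := by
  have hvertical : Integrable fun x : ℝ ↦ ∫ y in a..b, h (x + y * Complex.I) := by
    simpa only [intervalIntegral.integral_of_le hab] using hstrip.integral_prod_left
  have hzero := integral_eq_zero_of_hasDerivAt_of_integrable
    (hasDerivAt_integral_vertical hab hcont hdiff) ((hbot.sub htop).smul Complex.I) hvertical
  rw [integral_smul, smul_eq_zero_iff_right Complex.I_ne_zero, integral_sub hbot htop] at hzero
  exact sub_eq_zero.1 hzero

end ContourShift

section UpperHalfPlane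

variable {E : Type*} [NormedAddCommGroup E] {g : ℂ → E} {C R : ℝ}

theorem exists_norm_le_mul_inv_one_add_sq (hcont : ContinuousOn g {z | 0 ≤ z.im})
    (hdecay : ∀ z : ℂ, 0 ≤ z.im → R ≤ ‖z‖ → ‖g z‖ ≤ C / ‖z‖ ^ 2) :
    ∃ C', ∀ z : ℂ, 0 ≤ z.im → ‖g z‖ ≤ C' * (1 + ‖z‖ ^ 2)⁻¹ := by
  have hcompact : IsCompact (Metric.closedBall (0 : ℂ) (max R 1) ∩ {z | 0 ≤ z.im}) :=
    (isCompact_closedBall _ _).inter_right (isClosed_le continuous_const Complex.continuous_im)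
  obtain ⟨B, hB⟩ := hcompact.exists_bound_of_continuousOn (hcont.mono Set.inter_subset_right)
  refine ⟨max (2 * |C|) (|B| * (1 + (max R 1) ^ 2)), fun z hz ↦ ?_⟩
  rw [← div_eq_mul_inv, le_div_iff₀ (by positivity)]
  rcases le_total ‖z‖ (max R 1) with h | h
  · refine le_trans ?_ (le_max_right _ _)
    have := (hB z ⟨by simpa using h, hz⟩).trans (le_abs_self B)
    gcongr
  · refine le_trans ?_ (le_max_left _ _)
    have hone : 1 ≤ ‖z‖ := (le_max_right _ _).trans h
    have hmul : ‖g z‖ * ‖z‖ ^ 2 ≤ |C| := by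
      have := hdecay z hz ((le_max_left _ _).trans h)
      rw [le_div_iff₀ (by positivity)] at this
      exact this.trans (le_abs_self C)
    nlinarith [norm_nonneg (g z), mul_nonneg (norm_nonneg (g z)) (by nlinarith : 0 ≤ ‖z‖ ^ 2 - 1)]

theorem norm_apply_add_mul_I_le (hbound : ∀ z : ℂ, 0 ≤ z.im → ‖g z‖ ≤ C * (1 + ‖z‖ ^ 2)⁻¹)
    {η : ℝ} (hη : 0 ≤ η) (x : ℝ) : ‖g (x + η * Complex.I)‖ ≤ C * (1 + (x ^ 2 + η ^ 2))⁻¹ := by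
  simpa only [Complex.sq_norm, Complex.normSq_add_mul_I] using
    hbound (x + η * Complex.I) (by simpa using hη)

theorem norm_apply_add_mul_I_le_of_re (hbound : ∀ z : ℂ, 0 ≤ z.im → ‖g z‖ ≤ C * (1 + ‖z‖ ^ 2)⁻¹)
    {η : ℝ} (hη : 0 ≤ η) (x : ℝ) : ‖g (x + η * Complex.I)‖ ≤ C * (1 + x ^ 2)⁻¹ := by
  have hC : 0 ≤ C := by simpa using (norm_nonneg (g 0)).trans (hbound 0 le_rfl)
  refine (norm_apply_add_mul_I_le hbound hη x).trans ?_
  gcongr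
  nlinarith

variable (hcont : ContinuousOn g {z | 0 ≤ z.im})
  (hbound : ∀ z : ℂ, 0 ≤ z.im → ‖g z‖ ≤ C * (1 + ‖z‖ ^ 2)⁻¹)
include hcont hbound

theorem integrable_horizontal_of_decay {η : ℝ} (hη : 0 ≤ η) :
    Integrable fun x : ℝ ↦ g (x + η * Complex.I) :=
  (integrable_inv_one_add_sq.const_mul C).mono'
    (hcont.comp_continuous (by fun_prop) fun x ↦ by simpa using hη).aestronglyMeasurable
    (Eventually.of_forall (norm_apply_add_mul_I_le_of_re hbound hη))

theorem integrable_strip_of_decay (η : ℝ) :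
    Integrable (fun q : ℝ × ℝ ↦ g (q.1 + q.2 * Complex.I))
      (volume.prod (volume.restrict (Set.Ioc 0 η))) := by
  have hdominating := (integrable_inv_one_add_sq.const_mul C).comp_fst
    ((volume : Measure ℝ).restrict (Set.Ioc 0 η))
  have hstrip : MeasurableSet (Set.univ ×ˢ Set.Ioc 0 η : Set (ℝ × ℝ)) :=
    MeasurableSet.univ.prod measurableSet_Ioc
  rw [← Measure.restrict_univ (μ := (volume : Measure ℝ)), Measure.prod_restrict] at hdominating ⊢
  refine hdominating.mono' (ContinuousOn.aestronglyMeasurable (hcont.comp (by fun_prop)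
    fun q hq ↦ ?_) hstrip) (ae_restrict_of_forall_mem hstrip fun q hq ↦ ?_)
  · simpa using hq.2.1.le
  · exact norm_apply_add_mul_I_le_of_re hbound hq.2.1.le q.1

theorem integral_eq_zero_of_decay [NormedSpace ℂ E] [CompleteSpace E]
    (hdiff : DifferentiableOn ℂ g {z | 0 < z.im}) : ∫ x : ℝ, g x = 0 := by
  have hshift : ∀ η : ℝ, 0 ≤ η → ∫ x : ℝ, g (x + η * Complex.I) = ∫ x : ℝ, g x := fun η hη ↦ by
    simpa using (integral_horizontal_eq_of_integrable_strip hη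
      (hcont.mono fun z hz ↦ hz.1) (hdiff.mono fun z hz ↦ hz.1)
      (integrable_strip_of_decay hcont hbound η)
      (integrable_horizontal_of_decay hcont hbound le_rfl)
      (integrable_horizontal_of_decay hcont hbound hη)).symm
  have hpointwise : ∀ x : ℝ, Tendsto (fun η : ℝ ↦ g (x + η * Complex.I)) atTop (𝓝 0) := fun x ↦ by
    have hvanish : Tendsto (fun η : ℝ ↦ C * (1 + (x ^ 2 + η ^ 2))⁻¹) atTop (𝓝 (C * 0)) :=
      (tendsto_inv_atTop_zero.comp (tendsto_atTop_add_const_left _ _ (tendsto_atTop_add_const_left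
        _ _ (tendsto_pow_atTop two_ne_zero)))).const_mul C
    rw [mul_zero] at hvanish
    exact squeeze_zero_norm' ((eventually_ge_atTop 0).mono fun η hη ↦
      norm_apply_add_mul_I_le hbound hη x) hvanish
  have hlim := tendsto_integral_filter_of_dominated_convergence (fun x : ℝ ↦ C * (1 + x ^ 2)⁻¹)
    ((eventually_ge_atTop 0).mono fun η hη ↦
      (integrable_horizontal_of_decay hcont hbound hη).aestronglyMeasurable)
    ((eventually_ge_atTop 0).mono fun η hη ↦
      Eventually.of_forall (norm_apply_add_mul_I_le_of_re hbound hη))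
    (integrable_inv_one_add_sq.const_mul C) (Eventually.of_forall hpointwise)
  rw [integral_zero] at hlim
  exact tendsto_nhds_unique (tendsto_const_nhds.congr'
    ((eventually_ge_atTop 0).mono fun η hη ↦ (hshift η hη).symm)) hlim

end UpperHalfPlane

section CauchyFormula

variable {c : ℂ}

theorem sub_conj_ne_zero {z : ℂ} (hc : 0 < c.im) (hz : 0 ≤ z.im) : z - conj c ≠ 0 := fun h ↦ by
  have := congrArg Complex.im h
  simp only [Complex.sub_im, Complex.conj_im, Complex.zero_im] at this
  linarith

theorem norm_inv_sub_mul_sub_le {u v z : ℂ} (hz : z ≠ 0) (hu : 2 * ‖u‖ ≤ ‖z‖)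
    (hv : 2 * ‖v‖ ≤ ‖z‖) : ‖((z - u) * (z - v))⁻¹‖ ≤ 4 / ‖z‖ ^ 2 := by
  have := norm_pos_iff.2 hz
  have hu' : ‖z‖ / 2 ≤ ‖z - u‖ := by linarith [norm_sub_norm_le z u]
  have hv' : ‖z‖ / 2 ≤ ‖z - v‖ := by linarith [norm_sub_norm_le z v]
  rw [norm_inv, norm_mul]
  calc (‖z - u‖ * ‖z - v‖)⁻¹ ≤ (‖z‖ / 2 * (‖z‖ / 2))⁻¹ := by gcongr
    _ = 4 / ‖z‖ ^ 2 := by field_simp; norm_num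

theorem integral_inv_sub_conj_sq (hc : 0 < c.im) : ∫ t : ℝ, (((t : ℂ) - conj c) ^ 2)⁻¹ = 0 := by
  have hcont : ContinuousOn (fun z : ℂ ↦ ((z - conj c) ^ 2)⁻¹) {z | 0 ≤ z.im} :=
    ContinuousOn.inv₀ (by fun_prop) fun z hz ↦ pow_ne_zero 2 (sub_conj_ne_zero hc hz)
  obtain ⟨C, hC⟩ := exists_norm_le_mul_inv_one_add_sq (R := 2 * ‖c‖ + 1) (C := 4) hcont
    fun z _ hRz ↦ by
      have hconj : 2 * ‖conj c‖ ≤ ‖z‖ := by rw [RCLike.norm_conj]; linarith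
      rw [sq (z - conj c)]
      exact norm_inv_sub_mul_sub_le (norm_pos_iff.1 (by linarith [norm_nonneg c])) hconj hconj
  exact integral_eq_zero_of_decay hcont hC (DifferentiableOn.fun_inv (by fun_prop)
    fun z hz ↦ pow_ne_zero 2 (sub_conj_ne_zero hc (le_of_lt hz)))

theorem sub_mul_sub_conj_eq (c : ℂ) (t : ℝ) :
    ((t : ℂ) - c) * (t - conj c) = (((t - c.re) ^ 2 + c.im ^ 2 : ℝ) : ℂ) := by
  rw [← Complex.conj_ofReal t, ← map_sub, Complex.conj_ofReal, Complex.mul_conj,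
    Complex.normSq_apply]
  simp only [Complex.sub_re, Complex.ofReal_re, Complex.sub_im, Complex.ofReal_im]
  ring_nf

theorem inv_sub_mul_sub_conj_eq (hc : 0 < c.im) (t : ℝ) : (((t : ℂ) - c) * (t - conj c))⁻¹
    = (((c.im ^ 2)⁻¹ * (1 + ((t - c.re) / c.im) ^ 2)⁻¹ : ℝ) : ℂ) := by
  rw [sub_mul_sub_conj_eq, ← Complex.ofReal_inv, ← mul_inv]
  congr 2
  field_simp
  ring

theorem integrable_inv_sub_mul_sub_conj (hc : 0 < c.im) :
    Integrable fun t : ℝ ↦ (((t : ℂ) - c) * (t - conj c))⁻¹ := by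
  simp only [inv_sub_mul_sub_conj_eq hc]
  exact (((integrable_inv_one_add_sq.comp_div hc.ne').comp_sub_right c.re).const_mul _).ofReal

theorem integral_inv_sub_mul_sub_conj (hc : 0 < c.im) :
    ∫ t : ℝ, (((t : ℂ) - c) * (t - conj c))⁻¹ = π / c.im := by
  simp only [inv_sub_mul_sub_conj_eq hc]
  rw [integral_complex_ofReal, integral_const_mul,
    integral_sub_right_eq_self (fun t : ℝ ↦ (1 + (t / c.im) ^ 2)⁻¹) c.re,
    Measure.integral_comp_div (fun t : ℝ ↦ (1 + t ^ 2)⁻¹), integral_univ_inv_one_add_sq,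
    abs_of_pos hc, smul_eq_mul]
  push_cast
  field_simp

theorem integrable_inv_sub_sq (hc : 0 < c.im) :
    Integrable fun t : ℝ ↦ (((t : ℂ) - c) ^ 2)⁻¹ := by
  refine (integrable_inv_sub_mul_sub_conj hc).mono (by fun_prop) (Eventually.of_forall fun t ↦ ?_)
  have hconj : (t : ℂ) - conj c = conj (t - c) := by simp
  rw [norm_inv, norm_inv, norm_pow, norm_mul, hconj, RCLike.norm_conj, sq]

theorem integral_inv_sub_sq (hc : 0 < c.im) : ∫ t : ℝ, (((t : ℂ) - c) ^ 2)⁻¹ = 0 := by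
  rw [← map_zero (starRingEnd ℂ), ← integral_inv_sub_conj_sq hc, ← integral_conj]
  simp

variable {f : ℂ → ℂ} {M : ℝ}

theorem dslope_dslope_of_ne {z : ℂ} (hz : z ≠ c) : dslope (dslope f c) c z
    = (f z - f c) * ((z - c) ^ 2)⁻¹ - deriv f c / (z - c) := by
  have := sub_ne_zero.2 hz
  rw [dslope_of_ne _ hz, slope_def_field, dslope_of_ne _ hz, slope_def_field, dslope_same]
  field_simp

theorem dslope_dslope_add_div_sub_conj {z : ℂ} (hc : 0 < c.im) (hz : 0 ≤ z.im) (hzc : z ≠ c) :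
    dslope (dslope f c) c z + deriv f c / (z - conj c) = (f z - f c) * ((z - c) * (z - c))⁻¹
      - deriv f c * (c - conj c) * ((z - c) * (z - conj c))⁻¹ := by
  have hne := sub_ne_zero.2 hzc
  have hne' := sub_conj_ne_zero hc hz
  rw [dslope_dslope_of_ne hzc]
  field_simp
  ring

variable (hcont : ContinuousOn f {z | 0 ≤ z.im}) (hdiff : DifferentiableOn ℂ f {z | 0 < z.im})
  (hM : ∀ z : ℂ, 0 ≤ z.im → ‖f z‖ ≤ M) (hc : 0 < c.im)
include hcont hdiff hM hc

-- Adding `f' c / (z - conj c)` makes the second divided difference decay like `‖z‖⁻²`.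
theorem integral_dslope_dslope_add_div_sub_conj :
    Integrable (fun t : ℝ ↦ dslope (dslope f c) c t + deriv f c / (t - conj c)) ∧
      ∫ t : ℝ, (dslope (dslope f c) c t + deriv f c / (t - conj c)) = 0 := by
  let g : ℂ → ℂ := fun z ↦ dslope (dslope f c) c z + deriv f c / (z - conj c)
  have hopen : {z : ℂ | 0 < z.im} ∈ 𝓝 c :=
    (isOpen_lt continuous_const Complex.continuous_im).mem_nhds hc
  have hnhds : {z : ℂ | 0 ≤ z.im} ∈ 𝓝 c :=
    mem_of_superset hopen fun z (hz : 0 < z.im) ↦ le_of_lt hz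
  have hslope := (Complex.differentiableOn_dslope hopen).2 hdiff
  have hgcont : ContinuousOn g {z | 0 ≤ z.im} :=
    ((continuousOn_dslope hnhds).2 ⟨(continuousOn_dslope hnhds).2
      ⟨hcont, hdiff.differentiableAt hopen⟩, hslope.differentiableAt hopen⟩).add
      (ContinuousOn.div (by fun_prop) (by fun_prop) fun z ↦ sub_conj_ne_zero hc)
  have hgdiff : DifferentiableOn ℂ g {z | 0 < z.im} :=
    ((Complex.differentiableOn_dslope hopen).2 hslope).add
      (DifferentiableOn.fun_div (by fun_prop) (by fun_prop)
        fun z hz ↦ sub_conj_ne_zero hc (le_of_lt hz))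
  obtain ⟨C, hC⟩ := exists_norm_le_mul_inv_one_add_sq (R := 2 * ‖c‖ + 1)
    (C := (M + M) * 4 + ‖deriv f c * (c - conj c)‖ * 4) hgcont fun z hz hRz ↦ by
      have hz0 : z ≠ 0 := norm_pos_iff.1 (by linarith [norm_nonneg c])
      have hzc : z ≠ c := by rintro rfl; linarith [norm_nonneg z]
      have hcz : 2 * ‖c‖ ≤ ‖z‖ := by linarith
      have hM0 : 0 ≤ M := (norm_nonneg _).trans (hM z hz)
      simp only [g, dslope_dslope_add_div_sub_conj hc hz hzc, add_div, mul_div_assoc]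
      refine (norm_sub_le _ _).trans ?_
      rw [norm_mul, norm_mul _ (((z - c) * (z - conj c))⁻¹)]
      gcongr
      · exact (norm_sub_le _ _).trans (add_le_add (hM z hz) (hM c hc.le))
      · exact norm_inv_sub_mul_sub_le hz0 hcz hcz
      · exact norm_inv_sub_mul_sub_le hz0 hcz (by rwa [RCLike.norm_conj])
  exact ⟨by simpa using integrable_horizontal_of_decay hgcont hC le_rfl,
    integral_eq_zero_of_decay hgcont hC hgdiff⟩

theorem integral_mul_inv_sub_sq :
    ∫ t : ℝ, f t * (((t : ℂ) - c) ^ 2)⁻¹ = 2 * π * Complex.I * deriv f c := by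
  obtain ⟨hint, hzero⟩ := integral_dslope_dslope_add_div_sub_conj hcont hdiff hM hc
  have hsplit : ∀ t : ℝ, f t * (((t : ℂ) - c) ^ 2)⁻¹ =
      (dslope (dslope f c) c t + deriv f c / (t - conj c)) + f c * (((t : ℂ) - c) ^ 2)⁻¹
        + deriv f c * (c - conj c) * (((t : ℂ) - c) * (t - conj c))⁻¹ := fun t ↦ by
    have htc : (t : ℂ) ≠ c := fun h ↦ hc.ne' (by rw [← h, Complex.ofReal_im])
    rw [dslope_dslope_add_div_sub_conj hc (by simp) htc, sq]
    ring
  have hci : (c.im : ℂ) ≠ 0 := Complex.ofReal_ne_zero.2 hc.ne'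
  simp only [hsplit]
  rw [integral_add (hint.fun_add ((integrable_inv_sub_sq hc).const_mul _))
      ((integrable_inv_sub_mul_sub_conj hc).const_mul _),
    integral_add hint ((integrable_inv_sub_sq hc).const_mul _), integral_const_mul,
    integral_const_mul, hzero, integral_inv_sub_sq hc, integral_inv_sub_mul_sub_conj hc,
    Complex.sub_conj]
  push_cast
  field_simp
  ring

end CauchyFormula

/-! ### Elementary properties of the Hardy space -/

section HardySpace

open Metric Set

variable {p : ℂ → ℝ} {F : ℂ × ℂ → ℂ} {ε : ℝ}

/-- The square of the norm of the Hardy space `H²`. -/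
noncomputable def hardyNormSq (p : ℂ → ℝ) (F : ℂ × ℂ → ℂ) : ℝ≥0∞ :=
  ⨆ ε : Ioi (0 : ℝ), ∫⁻ q : ℂ × ℝ, ‖slice p F ε q‖ₑ ^ 2

theorem isOpen_domainAbove (hp : Continuous p) : IsOpen (domainAbove p) :=
  isOpen_lt (hp.comp continuous_fst) (Complex.continuous_im.comp continuous_snd)

theorem slice_mem_domainAbove (p : ℂ → ℝ) (hε : 0 < ε) (q : ℂ × ℝ) :
    (q.1, (q.2 : ℂ) + Complex.I * (p q.1 : ℂ) + Complex.I * (ε : ℂ)) ∈ domainAbove p := by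
  simp [domainAbove, hε]

theorem continuousOn_slice (hp : Continuous p) (hF : ContinuousOn F (domainAbove p)) :
    ContinuousOn (fun x : (ℂ × ℝ) × ℝ ↦ slice p F x.2 x.1) (univ ×ˢ Ioi 0) :=
  hF.comp (by fun_prop) fun x hx ↦ slice_mem_domainAbove p hx.2 x.1

theorem continuous_slice (hp : Continuous p) (hF : ContinuousOn F (domainAbove p)) (hε : 0 < ε) :
    Continuous (slice p F ε) :=
  (continuousOn_slice hp hF).comp_continuous (by fun_prop : Continuous fun q ↦ (q, ε))
    fun q ↦ ⟨mem_univ q, hε⟩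

theorem lintegral_slice_le (F : ℂ × ℂ → ℂ) (hε : 0 < ε) :
    ∫⁻ q : ℂ × ℝ, ‖slice p F ε q‖ₑ ^ 2 ≤ hardyNormSq p F :=
  le_iSup (fun ε : Ioi (0 : ℝ) ↦ ∫⁻ q : ℂ × ℝ, ‖slice p F ε q‖ₑ ^ 2) ⟨ε, hε⟩

theorem eLpNorm_two_sq {X E : Type*} [MeasurableSpace X] [NormedAddCommGroup E] (μ : Measure X)
    (f : X → E) : eLpNorm f 2 μ ^ 2 = ∫⁻ x, ‖f x‖ₑ ^ 2 ∂μ := by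
  simpa using eLpNorm_nnreal_pow_eq_lintegral (f := f) (μ := μ) (p := 2) two_ne_zero

theorem memLp_two_of_lintegral_lt_top {X E : Type*} [MeasurableSpace X] [NormedAddCommGroup E]
    {μ : Measure X} {f : X → E} (hf : AEStronglyMeasurable f μ)
    (h : ∫⁻ x, ‖f x‖ₑ ^ 2 ∂μ < ∞) : MemLp f 2 μ :=
  ⟨hf, (ENNReal.pow_lt_top_iff.1 ((eLpNorm_two_sq μ f).trans_lt h)).resolve_right two_ne_zero⟩

theorem memLp_slice (hp : Continuous p) (hF : F ∈ hardySpace p) (hε : 0 < ε) :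
    MemLp (slice p F ε) 2 volume :=
  memLp_two_of_lintegral_lt_top (continuous_slice hp hF.1.continuousOn hε).aestronglyMeasurable
    ((lintegral_slice_le F hε).trans_lt hF.2)

/-! ### Layers of the domain and pointwise estimates -/

section Layer

variable {s : Set ℝ} {g : ℝ → ℝ}

theorem aestronglyMeasurable_layer (hp : Continuous p) (hF : ContinuousOn F (domainAbove p))
    (hs : MeasurableSet s) (hg : Continuous g) (hpos : ∀ y ∈ s, 0 < g y) :
    AEStronglyMeasurable (fun x : (ℂ × ℝ) × ℝ ↦ slice p F (g x.2) x.1)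
      (volume.prod (volume.restrict s)) := by
  rw [← Measure.restrict_univ (μ := (volume : Measure (ℂ × ℝ))), Measure.prod_restrict]
  refine ContinuousOn.aestronglyMeasurable ?_ (MeasurableSet.univ.prod hs)
  exact (continuousOn_slice hp hF).comp
    (by fun_prop : Continuous fun x : (ℂ × ℝ) × ℝ ↦ (x.1, g x.2)).continuousOn
    fun x hx ↦ ⟨mem_univ _, hpos x.2 hx.2⟩

theorem lintegral_layer_le (hp : Continuous p) (hF : ContinuousOn F (domainAbove p))
    (hs : MeasurableSet s) (hg : Continuous g) (hpos : ∀ y ∈ s, 0 < g y) :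
    ∫⁻ x : (ℂ × ℝ) × ℝ, ‖slice p F (g x.2) x.1‖ₑ ^ 2 ∂(volume.prod (volume.restrict s)) ≤
      hardyNormSq p F * volume s := by
  rw [lintegral_prod_symm _ ((aestronglyMeasurable_layer hp hF hs hg hpos).enorm.pow_const 2)]
  calc ∫⁻ y in s, ∫⁻ q : ℂ × ℝ, ‖slice p F (g y) q‖ₑ ^ 2
      ≤ ∫⁻ _ in s, hardyNormSq p F :=
        setLIntegral_mono' hs fun y hy ↦ lintegral_slice_le F (hpos y hy)
    _ = hardyNormSq p F * volume s := setLIntegral_const s _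

theorem memLp_layer (hp : Continuous p) (hF : F ∈ hardySpace p) (hs : MeasurableSet s)
    (hs' : volume s ≠ ∞) (hg : Continuous g) (hpos : ∀ y ∈ s, 0 < g y) :
    MemLp (fun x : (ℂ × ℝ) × ℝ ↦ slice p F (g x.2) x.1) 2
      (volume.prod (volume.restrict s)) :=
  memLp_two_of_lintegral_lt_top
    (aestronglyMeasurable_layer hp hF.1.continuousOn hs hg hpos)
    ((lintegral_layer_le hp hF.1.continuousOn hs hg hpos).trans_lt
      (ENNReal.mul_lt_top hF.2 hs'.lt_top))

end Layer

theorem measurePreserving_layerCoordinates (hp : Measurable p) :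
    MeasurePreserving (fun x : (ℂ × ℝ) × ℝ ↦
      (x.1.1, (x.1.2 : ℂ) + Complex.I * p x.1.1 + Complex.I * x.2)) := by
  have hshear : MeasurePreserving (fun z : ℂ × ℂ ↦ (z.1, z.2 + Complex.I * p z.1)) :=
    (MeasurePreserving.id volume).skew_product (by fun_prop)
      (ae_of_all _ fun u ↦ (measurePreserving_add_right volume (Complex.I * (p u : ℂ))).map_eq)
  have hplane := (MeasurePreserving.id (volume : Measure ℂ)).prod
    Complex.volume_preserving_equiv_real_prod.symm
  convert (hshear.comp hplane).comp
    (measurePreserving_prodAssoc (volume : Measure ℂ) volume volume) using 1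
  · ext x : 1
    simp [Complex.measurableEquivRealProd, Complex.ext_iff, MeasurableEquiv.prodAssoc, add_comm]
  · rfl

theorem setLIntegral_sq_enorm_le (hp : Continuous p) (hF : ContinuousOn F (domainAbove p))
    {B : Set (ℂ × ℂ)} (hB : MeasurableSet B) {h : ℝ} (hBh : ∀ z ∈ B, z.2.im - p z.1 ∈ Ioo 0 h) :
    ∫⁻ z in B, ‖F z‖ₑ ^ 2 ≤ hardyNormSq p F * ENNReal.ofReal h := by
  set Ψ : (ℂ × ℝ) × ℝ → ℂ × ℂ := fun x ↦
    (x.1.1, (x.1.2 : ℂ) + Complex.I * p x.1.1 + Complex.I * x.2)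
  have hΨ := (measurePreserving_layerCoordinates hp.measurable).restrict_preimage hB
  have hFB : ContinuousOn F B := hF.mono fun z hz ↦ sub_pos.1 (hBh z hz).1
  have hlayer : Ψ ⁻¹' B ⊆ univ ×ˢ Ioo 0 h := fun x hx ↦ by simpa [Ψ] using hBh _ hx
  calc ∫⁻ z in B, ‖F z‖ₑ ^ 2 = ∫⁻ x in Ψ ⁻¹' B, ‖F (Ψ x)‖ₑ ^ 2 := by
        rw [← hΨ.map_eq, lintegral_map' _ hΨ.aemeasurable]
        rw [hΨ.map_eq]
        exact (hFB.aestronglyMeasurable hB).enorm.pow_const 2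
    _ ≤ ∫⁻ x in univ ×ˢ Ioo 0 h, ‖F (Ψ x)‖ₑ ^ 2 := lintegral_mono_set hlayer
    _ = ∫⁻ x : (ℂ × ℝ) × ℝ, ‖slice p F x.2 x.1‖ₑ ^ 2
          ∂(volume.prod (volume.restrict (Ioo 0 h))) := by
        rw [Measure.volume_eq_prod, ← Measure.prod_restrict, Measure.restrict_univ]
        rfl
    _ ≤ hardyNormSq p F * ENNReal.ofReal h := by
        simpa using lintegral_layer_le hp hF measurableSet_Ioo continuous_id fun y hy ↦ hy.1

theorem exists_sq_norm_le_div_of_mem_hardySpace (hp : Continuous p) (hF : F ∈ hardySpace p) (a : ℂ)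
    (hε : 0 < ε) :
    ∃ C : ℝ, 0 ≤ C ∧ ∀ b : ℂ, p a + ε ≤ b.im → ‖F (a, b)‖ ^ 2 ≤ C / (b.im - p a) := by
  obtain ⟨ρ, hρ, hρp⟩ := Metric.nhds_basis_closedBall.eventually_iff.1
    ((hp.tendsto a).eventually (closedBall_mem_nhds (p a) (by linarith : 0 < ε / 4)))
  set N := hardyNormSq p F
  refine ⟨8 * N.toReal / (π ^ 2 * ρ ^ 2), by positivity, fun b hb ↦ ?_⟩
  set y := b.im - p a
  have hy0 : 0 < y := by linarith
  have hheight : ∀ z ∈ closedBall a ρ ×ˢ closedBall b (y / 2), z.2.im - p z.1 ∈ Ioo 0 (2 * y) := by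
    intro z hz
    have hpz := hρp hz.1
    rw [Real.dist_eq, abs_le] at hpz
    have him := (Complex.abs_im_le_norm (z.2 - b)).trans (mem_closedBall_iff_norm.1 hz.2)
    rw [Complex.sub_im, abs_le] at him
    constructor <;> linarith
  have hmean := (sq_enorm_le_lintegral_bidisc hρ.le (half_pos hy0).le
    (hF.1.mono fun z hz ↦ sub_pos.1 (hheight z hz).1)).trans
    (setLIntegral_sq_enorm_le hp hF.1.continuousOn (measurableSet_ball.prod measurableSet_ball)
      fun z hz ↦ hheight z (prod_mono ball_subset_closedBall ball_subset_closedBall hz))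
  have hmean' := ENNReal.toReal_mono (ENNReal.mul_ne_top hF.2.ne ENNReal.ofReal_ne_top) hmean
  simp only [ENNReal.toReal_mul, ENNReal.toReal_pow, toReal_enorm] at hmean'
  rw [ENNReal.toReal_ofReal (by positivity), ENNReal.toReal_ofReal (by positivity),
    ENNReal.toReal_ofReal (by positivity)] at hmean'
  rw [div_div, le_div_iff₀ (by positivity)]
  refine le_of_mul_le_mul_left (a := y) ?_ hy0
  change _ ≤ N.toReal * _ at hmean'
  linarith

theorem exists_norm_le_of_mem_hardySpace (hp : Continuous p) (hF : F ∈ hardySpace p) (a : ℂ)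
    (hε : 0 < ε) : ∃ M : ℝ, ∀ b : ℂ, p a + ε ≤ b.im → ‖F (a, b)‖ ≤ M := by
  obtain ⟨C, hC0, hC⟩ := exists_sq_norm_le_div_of_mem_hardySpace hp hF a hε
  refine ⟨√(C / ε), fun b hb ↦ Real.le_sqrt_of_sq_le ((hC b hb).trans ?_)⟩
  gcongr
  linarith

theorem tendsto_zero_of_mem_hardySpace (hp : Continuous p) (hF : F ∈ hardySpace p) (a : ℂ)
    {ι : Type*} {𝓕 : Filter ι} {b : ι → ℂ} (hb : Tendsto (fun i ↦ (b i).im) 𝓕 atTop) :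
    Tendsto (fun i ↦ F (a, b i)) 𝓕 (𝓝 0) := by
  obtain ⟨C, -, hC⟩ := exists_sq_norm_le_div_of_mem_hardySpace hp hF a one_pos
  have hquot : Tendsto (fun i ↦ C / ((b i).im - p a)) 𝓕 (𝓝 0) :=
    tendsto_const_nhds.div_atTop (tendsto_atTop_add_const_right _ _ hb)
  have hsq : Tendsto (fun i ↦ ‖F (a, b i)‖ ^ 2) 𝓕 (𝓝 0) :=
    squeeze_zero' (Eventually.of_forall fun i ↦ sq_nonneg _)
      ((hb.eventually_ge_atTop (p a + 1)).mono fun i hi ↦ hC _ hi) hquot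
  rw [tendsto_zero_iff_norm_tendsto_zero]
  simpa only [Real.sqrt_sq (norm_nonneg _), Real.sqrt_zero] using hsq.sqrt

end HardySpace

/-! ### Existence and uniqueness of boundary values -/

theorem antitoneOn_of_two_mul_midpoint_le {N : ℝ → ℝ} {c M : ℝ} (hM : ∀ x > c, N x ≤ M)
    (hmid : ∀ x > c, ∀ y > c, 2 * N ((x + y) / 2) ≤ N x + N y) : AntitoneOn N (Set.Ioi c) := by
  intro a ha b _ hab
  by_contra! hlt
  set x : ℕ → ℝ := fun k ↦ a + k * (b - a)
  have hx : ∀ k, c < x k := fun k ↦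
    lt_add_of_lt_of_nonneg ha (mul_nonneg k.cast_nonneg (sub_nonneg.2 hab))
  have hstep : ∀ k, N b - N a ≤ N (x (k + 1)) - N (x k) := by
    intro k
    induction k with
    | zero => simp [x]
    | succ k ih =>
      have h := hmid (x k) (hx k) (x (k + 1 + 1)) (hx _)
      rw [show (x k + x (k + 1 + 1)) / 2 = x (k + 1) by simp only [x]; push_cast; ring] at h
      linarith
  have hsum : ∀ k : ℕ, N a + k * (N b - N a) ≤ N (x k) := by
    intro k
    induction k with
    | zero => simp [x]
    | succ k ih =>
      have h := hstep k
      push_cast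
      linarith
  obtain ⟨k, hk⟩ := exists_nat_gt ((M - N a) / (N b - N a))
  rw [div_lt_iff₀ (sub_pos.2 hlt)] at hk
  linarith [hsum k, hM _ (hx k)]

section HilbertSpace

variable {H : Type*} [NormedAddCommGroup H] [InnerProductSpace ℂ H] {u : ℝ → H}

theorem norm_sub_sq_of_inner_shift
    (hshift : ∀ ε > 0, ∀ δ > 0, ∀ η > 0, inner ℂ (u (ε + η)) (u δ) = inner ℂ (u ε) (u (δ + η)))
    {ε δ : ℝ} (hε : 0 < ε) (hδ : 0 < δ) :
    ‖u ε - u δ‖ ^ 2 = ‖u ε‖ ^ 2 + ‖u δ‖ ^ 2 - 2 * ‖u ((ε + δ) / 2)‖ ^ 2 := by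
  wlog hεδ : ε ≤ δ generalizing ε δ
  · rw [norm_sub_rev, this hδ hε (not_le.1 hεδ).le, add_comm δ ε]
    ring
  obtain rfl | hlt := hεδ.eq_or_lt
  · simp only [sub_self, norm_zero, add_self_div_two]
    ring
  · have h := hshift ε hε ((ε + δ) / 2) (by linarith) ((δ - ε) / 2) (by linarith)
    rw [show ε + (δ - ε) / 2 = (ε + δ) / 2 by ring,
      show (ε + δ) / 2 + (δ - ε) / 2 = δ by ring] at h
    rw [norm_sub_sq (𝕜 := ℂ), ← h, inner_self_eq_norm_sq]
    ring

theorem exists_tendsto_of_inner_shift [CompleteSpace H] {M : ℝ} (hM : ∀ ε > 0, ‖u ε‖ ^ 2 ≤ M)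
    (hshift : ∀ ε > 0, ∀ δ > 0, ∀ η > 0, inner ℂ (u (ε + η)) (u δ) = inner ℂ (u ε) (u (δ + η))) :
    ∃ f, Tendsto u (𝓝[>] 0) (𝓝 f) := by
  set N : ℝ → ℝ := fun ε ↦ ‖u ε‖ ^ 2
  have hsub : ∀ ε > 0, ∀ δ > 0, ‖u ε - u δ‖ ^ 2 = N ε + N δ - 2 * N ((ε + δ) / 2) :=
    fun ε hε δ hδ ↦ norm_sub_sq_of_inner_shift hshift hε hδ
  have hanti : AntitoneOn N (Set.Ioi 0) := antitoneOn_of_two_mul_midpoint_le hM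
    fun ε hε δ hδ ↦ sub_nonneg.1 ((sq_nonneg _).trans_eq (hsub ε hε δ hδ))
  have hbdd : BddAbove (N '' Set.Ioi 0) := ⟨M, Set.forall_mem_image.2 hM⟩
  have hle : ∀ ε > 0, N ε ≤ sSup (N '' Set.Ioi 0) := fun ε hε ↦
    le_csSup hbdd (Set.mem_image_of_mem _ hε)
  apply cauchy_map_iff_exists_tendsto.1
  rw [Metric.cauchy_iff]
  refine ⟨inferInstance, fun e he ↦ ?_⟩
  obtain ⟨_, ⟨a, ha, rfl⟩, hNa⟩ := exists_lt_of_lt_csSup (Set.nonempty_Ioi.image N)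
    (sub_lt_self (sSup (N '' Set.Ioi 0)) (half_pos (sq_pos_of_pos he)))
  refine ⟨u '' Set.Ioo 0 a, image_mem_map (Ioo_mem_nhdsGT ha), ?_⟩
  rintro _ ⟨ε, hε, rfl⟩ _ ⟨δ, hδ, rfl⟩
  rw [dist_eq_norm, ← sq_lt_sq₀ (norm_nonneg _) he.le, hsub ε hε.1 δ hδ.1]
  have hmid : N a ≤ N ((ε + δ) / 2) :=
    hanti (half_pos (add_pos hε.1 hδ.1)) ha (by linarith [hε.2, hδ.2])
  linarith [hle ε hε.1, hle δ hδ.1]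

end HilbertSpace

section BoundaryValue

variable {p : ℂ → ℝ} {F G : ℂ × ℂ → ℂ} {ε δ η : ℝ}

theorem integrable_slice_mul_conj_slice (hp : Continuous p) (hF : F ∈ hardySpace p)
    (hG : G ∈ hardySpace p) (hε : 0 < ε) (hδ : 0 < δ) :
    Integrable (fun q ↦ slice p F ε q * conj (slice p G δ q)) (volume.prod volume) :=
  (memLp_slice hp hF hε).integrable_mul (memLp_slice hp hG hδ).star

theorem ae_integrable_slice_mul_conj_slice (hp : Continuous p) (hF : F ∈ hardySpace p)
    (hG : G ∈ hardySpace p) (hε : 0 < ε) (hδ : 0 < δ) (η : ℝ) :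
    ∀ᵐ ζ : ℂ, Integrable (fun q : ℝ × ℝ ↦
      slice p F (ε + q.2) (ζ, q.1) * conj (slice p G (δ + η - q.2) (ζ, q.1)))
      (volume.prod (volume.restrict (Set.Ioc 0 η))) := by
  have hlayer : Integrable (fun x : (ℂ × ℝ) × ℝ ↦
      slice p F (ε + x.2) x.1 * conj (slice p G (δ + η - x.2) x.1))
      (volume.prod (volume.restrict (Set.Ioc 0 η))) :=
    (memLp_layer hp hF measurableSet_Ioc measure_Ioc_lt_top.ne (by fun_prop)
      fun y hy ↦ by linarith [hy.1]).integrable_mul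
    (memLp_layer hp hG measurableSet_Ioc measure_Ioc_lt_top.ne (by fun_prop)
      fun y hy ↦ by linarith [hy.2]).star
  exact (((measurePreserving_prodAssoc (volume : Measure ℂ) (volume : Measure ℝ)
    (volume.restrict (Set.Ioc 0 η))).symm _).integrable_comp_emb
    (MeasurableEquiv.measurableEmbedding _) |>.2 hlayer).prod_right_ae

theorem differentiableOn_mul_conj_conj (hF : DifferentiableOn ℂ F (domainAbove p))
    (hp : Continuous p) (hG : DifferentiableOn ℂ G (domainAbove p)) (ε δ : ℝ) (ζ : ℂ) :
    DifferentiableOn ℂ (fun z ↦ F (ζ, z + Complex.I * p ζ + Complex.I * ε) *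
      conj (G (ζ, conj z + Complex.I * p ζ + Complex.I * δ))) (Complex.im ⁻¹' Set.Ioo (-ε) δ) := by
  intro z hz
  refine DifferentiableAt.differentiableWithinAt (DifferentiableAt.mul ?_ ?_)
  · refine (hF.differentiableAt ((isOpen_domainAbove hp).mem_nhds ?_)).comp z (by fun_prop)
    simpa [domainAbove, ← sub_pos, add_sub_right_comm] using hz.1
  · have hG' : DifferentiableAt ℂ (fun w ↦ G (ζ, w + Complex.I * p ζ + Complex.I * δ))
        (conj z) := by
      refine (hG.differentiableAt ((isOpen_domainAbove hp).mem_nhds ?_)).comp _ (by fun_prop)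
      simpa [domainAbove, ← sub_pos, add_sub_right_comm, neg_add_eq_sub] using hz.2
    simpa [Function.comp_def] using hG'.conj_conj

theorem integral_slice_mul_conj_slice_shift (hp : Continuous p) (hF : F ∈ hardySpace p)
    (hG : G ∈ hardySpace p) (hε : 0 < ε) (hδ : 0 < δ) (hη : 0 ≤ η) :
    ∫ q, slice p F (ε + η) q * conj (slice p G δ q) =
      ∫ q, slice p F ε q * conj (slice p G (δ + η) q) := by
  have hbot := integrable_slice_mul_conj_slice hp hF hG hε (add_pos_of_pos_of_nonneg hδ hη)
  have htop := integrable_slice_mul_conj_slice hp hF hG (add_pos_of_pos_of_nonneg hε hη) hδ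
  rw [Measure.volume_eq_prod, integral_prod _ htop, integral_prod _ hbot]
  refine integral_congr_ae ?_
  filter_upwards [hbot.prod_right_ae, htop.prod_right_ae,
    ae_integrable_slice_mul_conj_slice hp hF hG hε hδ η] with ζ hbotζ htopζ hstripζ
  set h : ℂ → ℂ := fun z ↦ F (ζ, z + Complex.I * p ζ + Complex.I * ε) *
      conj (G (ζ, conj z + Complex.I * p ζ + Complex.I * ((δ + η : ℝ) : ℂ)))
  have hh : ∀ x y : ℝ, h (x + y * Complex.I) =
      slice p F (ε + y) (ζ, x) * conj (slice p G (δ + η - y) (ζ, x)) := by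
    intro x y
    simp only [h, slice, map_add, map_mul, Complex.conj_ofReal, Complex.conj_I]
    push_cast
    ring_nf
  have hdiff := differentiableOn_mul_conj_conj hF.1 hp hG.1 ε (δ + η) ζ
  have hshift := integral_horizontal_eq_of_integrable_strip (h := h) hη
    (hdiff.continuousOn.mono fun z hz ↦ ⟨by linarith [hz.1], by linarith [hz.2]⟩)
    (hdiff.mono fun z hz ↦ ⟨by linarith [hz.1], by linarith [hz.2]⟩)
    (by simpa only [hh] using hstripζ) (by simpa only [hh, add_zero, sub_zero] using hbotζ)
    (by simpa only [hh, add_sub_cancel_right] using htopζ)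
  simpa only [hh, add_zero, sub_zero, add_sub_cancel_right] using hshift.symm

theorem inner_toLp_two {X : Type*} [MeasurableSpace X] {μ : Measure X} {f g : X → ℂ}
    (hf : MemLp f 2 μ) (hg : MemLp g 2 μ) :
    inner ℂ (hf.toLp f) (hg.toLp g) = ∫ x, g x * conj (f x) ∂μ := by
  rw [L2.inner_def]
  refine integral_congr_ae ?_
  filter_upwards [hf.coeFn_toLp, hg.coeFn_toLp] with x hfx hgx
  rw [hfx, hgx, RCLike.inner_apply]

theorem exists_isBoundaryValue (hp : Continuous p) (hF : F ∈ hardySpace p) :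
    ∃ f, IsBoundaryValue p F f := by
  classical
  set u : ℝ → Lp ℂ 2 (volume : Measure (ℂ × ℝ)) := fun ε ↦
    if h : 0 < ε then (memLp_slice hp hF h).toLp _ else 0
  have hu : ∀ {ε : ℝ} (h : 0 < ε), u ε = (memLp_slice hp hF h).toLp _ := fun h ↦ dif_pos h
  obtain ⟨f, hf⟩ := exists_tendsto_of_inner_shift (u := u) (M := (hardyNormSq p F).toReal)
    (fun ε hε ↦ by
      rw [hu hε, Lp.norm_toLp, ← ENNReal.toReal_pow, eLpNorm_two_sq]
      exact ENNReal.toReal_mono hF.2.ne (lintegral_slice_le F hε))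
    (fun ε hε δ hδ η hη ↦ by
      rw [hu hδ, hu hε, hu (add_pos hε hη), hu (add_pos hδ hη), inner_toLp_two, inner_toLp_two]
      exact (integral_slice_mul_conj_slice_shift hp hF hF hδ hε hη.le).symm)
  refine ⟨f, Lp.memLp f, ((Lp.tendsto_Lp_iff_tendsto_eLpNorm' u f).1 hf).congr' ?_⟩
  filter_upwards [self_mem_nhdsWithin] with ε hε
  refine eLpNorm_congr_ae ?_
  rw [hu hε]
  filter_upwards [(memLp_slice hp hF hε).coeFn_toLp] with q hq
  simp [hq]

theorem IsBoundaryValue.ae_eq (hp : Continuous p) (hF : ContinuousOn F (domainAbove p))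
    {f g : ℂ × ℝ → ℂ} (hf : IsBoundaryValue p F f) (hg : IsBoundaryValue p F g) :
    f =ᵐ[volume] g := by
  have hsum : Tendsto (fun ε : ℝ ↦ eLpNorm (fun q ↦ slice p F ε q - g q) 2 volume +
      eLpNorm (fun q ↦ slice p F ε q - f q) 2 volume) (𝓝[>] 0) (𝓝 0) := by
    simpa using hg.2.add hf.2
  have hle : eLpNorm (f - g) 2 volume ≤ 0 := by
    refine ge_of_tendsto hsum ?_
    filter_upwards [self_mem_nhdsWithin] with ε hε
    have hslice := (continuous_slice hp hF hε).aestronglyMeasurable (μ := volume)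
    have hsub : f - g = (fun q ↦ slice p F ε q - g q) - (fun q ↦ slice p F ε q - f q) := by
      ext q
      simp
    rw [hsub]
    exact eLpNorm_sub_le (hslice.sub hg.1.1) (hslice.sub hf.1.1) one_le_two
  exact (sub_ae_eq_zero f g).1 <|
    (eLpNorm_eq_zero_iff (hf.1.1.sub hg.1.1) two_ne_zero).1 (nonpos_iff_eq_zero.1 hle)

end BoundaryValue

/-! ### The explicit Szegő kernel of the model domain -/

/-- The expression whose inverse square is, up to a constant, the Szegő kernel. -/
noncomputable def szegoBracket (κ : ℝ) (l : ℂ) (z w : ℂ × ℂ) : ℂ :=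
  Complex.I * (conj w.2 - z.2) - 2 * κ * z.1 * conj w.1 - (l * z.1 ^ 2 + conj l * conj w.1 ^ 2)

/-- The closed formula for the Szegő kernel of the model domain `D_{κ,l}`. -/
noncomputable def modelSzego (κ : ℝ) (l : ℂ) (z w : ℂ × ℂ) : ℂ :=
  κ / π ^ 2 * szegoBracket κ l z w ^ (-2 : ℤ)

theorem modelSzego_eq (κ : ℝ) (l : ℂ) (z w : ℂ × ℂ) :
    modelSzego κ l z w = κ / π ^ 2 * (szegoBracket κ l z w ^ 2)⁻¹ := by
  rw [modelSzego, zpow_neg]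
  norm_cast

theorem conj_szegoBracket (κ : ℝ) (l : ℂ) (z w : ℂ × ℂ) :
    conj (szegoBracket κ l z w) = szegoBracket κ l w z := by
  simp only [szegoBracket, map_sub, map_mul, map_add, map_pow, Complex.conj_conj,
    Complex.conj_ofReal, Complex.conj_I, map_ofNat]
  ring

theorem re_szegoBracket (κ : ℝ) (l : ℂ) (z w : ℂ × ℂ) :
    (szegoBracket κ l z w).re =
      (z.2.im - quad κ l z.1) + (w.2.im - quad κ l w.1) + κ * ‖z.1 - w.1‖ ^ 2 := by
  simp only [szegoBracket, quad, ← Complex.normSq_eq_norm_sq, Complex.normSq_apply]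
  simp [sq]
  ring

theorem differentiable_szegoBracket (κ : ℝ) (l : ℂ) (w : ℂ × ℂ) :
    Differentiable ℂ fun z ↦ szegoBracket κ l z w := by
  unfold szegoBracket
  fun_prop

theorem slice_szegoBracket (κ : ℝ) (l : ℂ) (w : ℂ × ℂ) (ε : ℝ) (q : ℂ × ℝ) :
    slice (quad κ l) (fun z ↦ szegoBracket κ l z w) ε q =
      slice (quad κ l) (fun z ↦ szegoBracket κ l z w) 0 q + ε := by
  simp only [slice, szegoBracket, Complex.ofReal_zero]
  linear_combination (-(ε : ℂ)) * Complex.I_sq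

theorem slice_modelSzego (κ : ℝ) (l : ℂ) (w : ℂ × ℂ) (ε : ℝ) (q : ℂ × ℝ) :
    slice (quad κ l) (fun z ↦ modelSzego κ l z w) ε q =
      κ / π ^ 2 * ((slice (quad κ l) (fun z ↦ szegoBracket κ l z w) 0 q + ε) ^ 2)⁻¹ := by
  rw [← slice_szegoBracket]
  exact modelSzego_eq ..

theorem re_slice_szegoBracket (κ : ℝ) (l : ℂ) (w : ℂ × ℂ) (q : ℂ × ℝ) :
    (slice (quad κ l) (fun z ↦ szegoBracket κ l z w) 0 q).re =
      (w.2.im - quad κ l w.1) + κ * ‖q.1 - w.1‖ ^ 2 := by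
  simp [slice, re_szegoBracket]

theorem im_slice_szegoBracket (κ : ℝ) (l : ℂ) (w : ℂ × ℂ) (q : ℂ × ℝ) :
    (slice (quad κ l) (fun z ↦ szegoBracket κ l z w) 0 q).im =
      (slice (quad κ l) (fun z ↦ szegoBracket κ l z w) 0 (q.1, 0)).im - q.2 := by
  simp [slice, szegoBracket]
  ring

theorem continuous_slice_szegoBracket (κ : ℝ) (l : ℂ) (w : ℂ × ℂ) (ε : ℝ) :
    Continuous (slice (quad κ l) (fun z ↦ szegoBracket κ l z w) ε) := by
  have hq := continuous_quad κ l
  exact (differentiable_szegoBracket κ l w).continuous.comp (by fun_prop)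

theorem norm_le_norm_add_ofReal {A : ℂ} (hA : 0 ≤ A.re) {ε : ℝ} (hε : 0 ≤ ε) :
    ‖A‖ ≤ ‖A + ε‖ := by
  rw [← sq_le_sq₀ (norm_nonneg _) (norm_nonneg _), ← Complex.normSq_eq_norm_sq,
    ← Complex.normSq_eq_norm_sq, Complex.normSq_add, Complex.conj_ofReal, Complex.re_mul_ofReal,
    add_assoc]
  exact le_add_of_nonneg_right (add_nonneg (Complex.normSq_nonneg _) (by positivity))

theorem norm_inv_sq_sub_inv_sq_le {A : ℂ} {δ : ℝ} (hδ : 0 < δ) (hA : δ ≤ A.re) {ε : ℝ}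
    (hε : 0 ≤ ε) : ‖((A + ε) ^ 2)⁻¹ - (A ^ 2)⁻¹‖ ≤ 2 * ε / δ * ‖(A ^ 2)⁻¹‖ := by
  have hnorm : ‖A‖ ≤ ‖A + ε‖ := norm_le_norm_add_ofReal (hδ.le.trans hA) hε
  have hδA : δ ≤ ‖A‖ := hA.trans (Complex.re_le_norm _)
  have hA0 : A ≠ 0 := norm_pos_iff.1 (hδ.trans_le hδA)
  have hAε : A + ε ≠ 0 := norm_pos_iff.1 (hδ.trans_le (hδA.trans hnorm))
  have hsub : ((A + ε) ^ 2)⁻¹ - (A ^ 2)⁻¹ = -(ε * (A + (A + ε))) / (A + ε) ^ 2 * (A ^ 2)⁻¹ := by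
    field_simp
    ring
  rw [hsub, norm_mul]
  gcongr
  rw [norm_div, norm_neg, norm_mul, norm_pow, Complex.norm_real, Real.norm_of_nonneg hε,
    div_le_div_iff₀ (by positivity) hδ]
  calc ε * ‖A + (A + ε)‖ * δ ≤ ε * (2 * ‖A + ε‖) * ‖A + ε‖ := by
        gcongr
        · exact (norm_add_le _ _).trans (by linarith)
        · exact hδA.trans hnorm
    _ = 2 * ε * ‖A + ε‖ ^ 2 := by ring

theorem sq_norm_inv_sq_le {A : ℂ} {m x : ℝ} (hm : 0 < m) (hx : 0 ≤ x)
    (hA : m * (1 + x) ≤ A.re) :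
    ‖(A ^ 2)⁻¹‖ ^ 2 ≤ (m ^ 2 * min (m ^ 2) 1)⁻¹ * (((1 + x) ^ 2)⁻¹ * (1 + A.im ^ 2)⁻¹) := by
  have : 0 < min (m ^ 2) 1 := lt_min (by positivity) one_pos
  have hre : m ^ 2 * (1 + x) ^ 2 ≤ ‖A‖ ^ 2 := by
    rw [← mul_pow]
    gcongr
    exact hA.trans (Complex.re_le_norm _)
  have him : min (m ^ 2) 1 * (1 + A.im ^ 2) ≤ ‖A‖ ^ 2 := by
    have hmA : m ^ 2 ≤ A.re ^ 2 := by
      gcongr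
      exact (le_mul_of_one_le_right hm.le (by linarith)).trans hA
    rw [← Complex.normSq_eq_norm_sq, Complex.normSq_apply, mul_add, mul_one, ← sq, ← sq]
    exact add_le_add ((min_le_left _ _).trans hmA)
      (mul_le_of_le_one_left (sq_nonneg _) (min_le_right _ _))
  rw [norm_inv, norm_pow, inv_pow, ← mul_inv, ← mul_inv]
  gcongr
  calc m ^ 2 * min (m ^ 2) 1 * ((1 + x) ^ 2 * (1 + A.im ^ 2))
      = (m ^ 2 * (1 + x) ^ 2) * (min (m ^ 2) 1 * (1 + A.im ^ 2)) := by ring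
    _ ≤ ‖A‖ ^ 2 * ‖A‖ ^ 2 := by gcongr
    _ = (‖A‖ ^ 2) ^ 2 := by ring

theorem integrable_inv_sq_one_add_sq_norm :
    Integrable (fun ζ : ℂ ↦ ((1 + ‖ζ‖ ^ 2) ^ 2)⁻¹) := by
  refine (integrable_rpow_neg_one_add_norm_sq (E := ℂ) (μ := volume) (r := 4)
    (by rw [Complex.finrank_real_complex]; norm_num)).congr (ae_of_all _ fun ζ ↦ ?_)
  simp only
  rw [show (-4 / 2 : ℝ) = ((-2 : ℤ) : ℝ) by norm_num, Real.rpow_intCast, zpow_neg]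
  norm_cast

theorem integrable_mul_comp_sub {X : Type*} [MeasurableSpace X] {μ : Measure X} [SFinite μ]
    {f : X → ℝ} {g : ℝ → ℝ} {b : X → ℝ} (hf : Integrable f μ) (hg : Integrable g)
    (hb : Measurable b) :
    Integrable (fun q : X × ℝ ↦ f q.1 * g (b q.1 - q.2)) (μ.prod volume) :=
  ((MeasurePreserving.id μ).skew_product (g := fun x t ↦ b x - t)
    ((hb.comp measurable_fst).sub measurable_snd)
    (ae_of_all _ fun x ↦
      (volume.measurePreserving_sub_left (b x)).map_eq)).integrable_comp_of_integrable
    (hf.mul_prod hg)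

section Domain

variable {κ : ℝ} {l : ℂ} {w : ℂ × ℂ}

theorem szegoBracket_ne_zero (hκ : 0 ≤ κ) {z : ℂ × ℂ} (hz : quad κ l z.1 ≤ z.2.im)
    (hw : w ∈ domainAbove (quad κ l)) : szegoBracket κ l z w ≠ 0 := fun h ↦ by
  have hre := re_szegoBracket κ l z w
  have hw' : quad κ l w.1 < w.2.im := hw
  have hnonneg : 0 ≤ κ * ‖z.1 - w.1‖ ^ 2 := by positivity
  rw [h, Complex.zero_re] at hre
  linarith

theorem sub_le_re_slice_szegoBracket (hκ : 0 ≤ κ) (q : ℂ × ℝ) :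
    w.2.im - quad κ l w.1 ≤ (slice (quad κ l) (fun z ↦ szegoBracket κ l z w) 0 q).re := by
  rw [re_slice_szegoBracket]
  exact le_add_of_nonneg_right (by positivity)

theorem norm_slice_modelSzego_le (hκ : 0 ≤ κ) (hw : w ∈ domainAbove (quad κ l)) {ε : ℝ}
    (hε : 0 ≤ ε) (q : ℂ × ℝ) :
    ‖slice (quad κ l) (fun z ↦ modelSzego κ l z w) ε q‖ ≤
      ‖slice (quad κ l) (fun z ↦ modelSzego κ l z w) 0 q‖ := by
  have hre := (sub_pos.2 hw).trans_le (sub_le_re_slice_szegoBracket hκ q)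
  have hnorm := hre.trans_le (Complex.re_le_norm _)
  simp only [slice_modelSzego, norm_mul, norm_inv, norm_pow, Complex.ofReal_zero, add_zero]
  gcongr
  exact norm_le_norm_add_ofReal hre.le hε

theorem norm_slice_modelSzego_sub_le (hκ : 0 ≤ κ) (hw : w ∈ domainAbove (quad κ l)) {ε : ℝ}
    (hε : 0 ≤ ε) (q : ℂ × ℝ) :
    ‖slice (quad κ l) (fun z ↦ modelSzego κ l z w) ε q -
        slice (quad κ l) (fun z ↦ modelSzego κ l z w) 0 q‖ ≤
      2 * ε / (w.2.im - quad κ l w.1) *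
        ‖slice (quad κ l) (fun z ↦ modelSzego κ l z w) 0 q‖ := by
  simp only [slice_modelSzego, Complex.ofReal_zero, add_zero]
  rw [← mul_sub, norm_mul, norm_mul, mul_left_comm]
  gcongr
  exact norm_inv_sq_sub_inv_sq_le (sub_pos.2 hw) (sub_le_re_slice_szegoBracket hκ q) hε

theorem continuous_slice_zero_modelSzego (hκ : 0 ≤ κ) (hw : w ∈ domainAbove (quad κ l)) :
    Continuous (slice (quad κ l) (fun z ↦ modelSzego κ l z w) 0) := by
  rw [funext (slice_modelSzego κ l w 0)]
  simp only [Complex.ofReal_zero, add_zero]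
  exact continuous_const.mul (((continuous_slice_szegoBracket κ l w 0).pow 2).inv₀ fun q ↦
    pow_ne_zero 2 (szegoBracket_ne_zero hκ (by simp) hw))

theorem memLp_slice_zero_modelSzego (hκ : 0 < κ) (hw : w ∈ domainAbove (quad κ l)) :
    MemLp (slice (quad κ l) (fun z ↦ modelSzego κ l z w) 0) 2 volume := by
  have hcont := continuous_slice_zero_modelSzego hκ.le hw
  rw [memLp_two_iff_integrable_sq_norm hcont.aestronglyMeasurable]
  set m := min (w.2.im - quad κ l w.1) κ
  have hm : 0 < m := lt_min (sub_pos.2 hw) hκ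
  set B := slice (quad κ l) (fun z ↦ szegoBracket κ l z w) 0
  have hB : Continuous B := continuous_slice_szegoBracket κ l w 0
  have hmajorant := integrable_mul_comp_sub
    (integrable_inv_sq_one_add_sq_norm.comp_sub_right w.1) integrable_inv_one_add_sq
    (b := fun ζ ↦ (B (ζ, 0)).im) (by fun_prop)
  refine (hmajorant.const_mul (‖(κ / π ^ 2 : ℂ)‖ ^ 2 * (m ^ 2 * min (m ^ 2) 1)⁻¹)).mono'
    (hcont.norm.pow 2).aestronglyMeasurable (ae_of_all _ fun q ↦ ?_)
  have hre : m * (1 + ‖q.1 - w.1‖ ^ 2) ≤ (B q).re := by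
    rw [re_slice_szegoBracket, mul_add, mul_one]
    gcongr
    · exact min_le_left _ _
    · exact min_le_right _ _
  rw [← im_slice_szegoBracket, Real.norm_of_nonneg (by positivity), slice_modelSzego, norm_mul,
    mul_pow, mul_assoc, Complex.ofReal_zero, add_zero]
  gcongr
  exact sq_norm_inv_sq_le hm (sq_nonneg _) hre

theorem isBoundaryValue_modelSzego (hκ : 0 < κ) (hw : w ∈ domainAbove (quad κ l)) :
    IsBoundaryValue (quad κ l) (fun z ↦ modelSzego κ l z w)
      (slice (quad κ l) (fun z ↦ modelSzego κ l z w) 0) := by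
  have hmem := memLp_slice_zero_modelSzego hκ hw
  refine ⟨hmem, ?_⟩
  have hfactor : Tendsto (fun ε : ℝ ↦ 2 * ε / (w.2.im - quad κ l w.1)) (𝓝[>] 0) (𝓝 0) := by
    have hcont : Continuous (fun ε : ℝ ↦ 2 * ε / (w.2.im - quad κ l w.1)) := by fun_prop
    simpa using (hcont.tendsto 0).mono_left nhdsWithin_le_nhds
  have hlim := ENNReal.Tendsto.mul_const (ENNReal.tendsto_ofReal hfactor) (Or.inr hmem.2.ne)
  rw [ENNReal.ofReal_zero, zero_mul] at hlim
  refine tendsto_of_tendsto_of_tendsto_of_le_of_le' tendsto_const_nhds hlim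
    (Eventually.of_forall fun _ ↦ bot_le) ?_
  filter_upwards [self_mem_nhdsWithin] with ε hε
  exact eLpNorm_le_mul_eLpNorm_of_ae_le_mul
    (ae_of_all _ fun q ↦ norm_slice_modelSzego_sub_le hκ.le hw (le_of_lt hε) q) 2

theorem modelSzego_mem_hardySpace (hκ : 0 < κ) (hw : w ∈ domainAbove (quad κ l)) :
    (fun z ↦ modelSzego κ l z w) ∈ hardySpace (quad κ l) := by
  constructor
  · intro z hz
    have hne := szegoBracket_ne_zero hκ.le (le_of_lt hz) hw
    simp only [modelSzego_eq]
    exact (((differentiable_szegoBracket κ l w z).fun_pow 2).fun_inv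
      (pow_ne_zero 2 hne)).const_mul _ |>.differentiableWithinAt
  · refine lt_of_le_of_lt (iSup_le fun ε ↦ ?_)
      (ENNReal.pow_lt_top (n := 2) (memLp_slice_zero_modelSzego hκ hw).2)
    rw [← eLpNorm_two_sq]
    exact pow_le_pow_left' (eLpNorm_mono fun q ↦
      norm_slice_modelSzego_le hκ.le hw (le_of_lt ε.2) q) 2

end Domain

/-! ### Mean values of the second partial derivative -/

section MeanValue

open Metric Set

variable {E : Type*} [NormedAddCommGroup E]

theorem circleAverage_circleAverage_comm [NormedSpace ℝ E] {f : ℂ → ℂ → E} {a b : ℂ} {r s : ℝ}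
    (hf : ContinuousOn (Function.uncurry f) (sphere a |r| ×ˢ sphere b |s|)) :
    Real.circleAverage (fun z ↦ Real.circleAverage (f z) b s) a r =
      Real.circleAverage (fun u ↦ Real.circleAverage (fun z ↦ f z u) a r) b s := by
  have hcont : Continuous fun x : ℝ × ℝ ↦ f (circleMap a r x.1) (circleMap b s x.2) :=
    hf.comp_continuous (f := fun x : ℝ × ℝ ↦ (circleMap a r x.1, circleMap b s x.2))
      (by fun_prop) fun x ↦ ⟨circleMap_mem_sphere' .., circleMap_mem_sphere' ..⟩
  simp only [Real.circleAverage, intervalIntegral.integral_smul]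
  rw [smul_comm, intervalIntegral_intervalIntegral_swap]
  exact (hcont.continuousOn.integrableOn_compact (isCompact_uIcc.prod isCompact_uIcc)).mono_set
    (prod_mono uIoc_subset_uIcc uIoc_subset_uIcc)

variable [NormedSpace ℂ E] [CompleteSpace E]

theorem deriv_eq_circleAverage {f : ℂ → E} {c : ℂ} {R : ℝ} (hR : 0 < R)
    (hf : DiffContOnCl ℂ f (ball c R)) :
    deriv f c = Real.circleAverage (fun u ↦ u⁻¹ • f (u + c)) 0 R := by
  have hshift := Real.circleAverage_map_add_const (f := fun z ↦ (z - c)⁻¹ • f z) (c := c) (R := R)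
  simp only [add_sub_cancel_right] at hshift
  rw [hshift, Real.circleAverage_eq_circleIntegral hR.ne',
    eq_inv_smul_iff₀ Complex.two_pi_I_ne_zero, ← hf.deriv_eq_smul_circleIntegral hR]
  simp only [smul_smul, one_div, ← sq, inv_pow]

theorem circleAverage_deriv_snd {F : ℂ × ℂ → E} {Ω : Set (ℂ × ℂ)} (hΩ : IsOpen Ω)
    (hF : DifferentiableOn ℂ F Ω) {γ : ℂ → ℂ} (hγ : Differentiable ℂ γ) {a : ℂ} {r : ℝ}
    (hr : 0 ≤ r) (hgraph : ∀ ζ ∈ closedBall a r, (ζ, γ ζ) ∈ Ω) :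
    Real.circleAverage (fun ζ ↦ deriv (fun v ↦ F (ζ, v)) (γ ζ)) a r =
      deriv (fun v ↦ F (a, v)) (γ a) := by
  have hγ_cont : Continuous γ := hγ.continuous
  obtain ⟨ρ, hρ, hρΩ⟩ := ((isCompact_closedBall a r).image
    (f := fun ζ ↦ (ζ, γ ζ)) (by fun_prop)).exists_cthickening_subset_open hΩ
      (image_subset_iff.2 hgraph)
  have hmem : ∀ ζ ∈ closedBall a r, ∀ v ∈ closedBall 0 ρ, (ζ, v + γ ζ) ∈ Ω := fun ζ hζ v hv ↦
    hρΩ (mem_cthickening_of_dist_le _ (ζ, γ ζ) _ _ (mem_image_of_mem (fun ζ ↦ (ζ, γ ζ)) hζ)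
      (by simpa [Prod.dist_eq] using hv))
  have hcauchy : ∀ ζ ∈ closedBall a r, deriv (fun v ↦ F (ζ, v)) (γ ζ) =
      Real.circleAverage (fun u ↦ u⁻¹ • F (ζ, u + γ ζ)) 0 ρ := fun ζ hζ ↦ by
    have hdiff : DifferentiableOn ℂ (fun v ↦ F (ζ, v)) (closedBall (γ ζ) ρ) :=
      hF.comp (by fun_prop) fun v hv ↦ by
        simpa using hmem ζ hζ (v - γ ζ) (by simpa [dist_eq_norm] using hv)
    exact deriv_eq_circleAverage hρ (hdiff.mono closure_ball_subset_closedBall).diffContOnCl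
  have hsphere : sphere a |r| ⊆ closedBall a r := by
    rw [abs_of_nonneg hr]
    exact sphere_subset_closedBall
  have hcont : ContinuousOn (Function.uncurry fun ζ u ↦ u⁻¹ • F (ζ, u + γ ζ))
      (sphere a |r| ×ˢ sphere 0 |ρ|) := by
    rw [abs_of_pos hρ]
    refine (continuousOn_snd.inv₀ fun x hx ↦ ne_of_mem_sphere hx.2 hρ.ne').smul
      (hF.continuousOn.comp (by fun_prop) fun x hx ↦ ?_)
    exact hmem _ (hsphere hx.1) _ (sphere_subset_closedBall hx.2)
  rw [Real.circleAverage_congr_sphere fun ζ hζ ↦ hcauchy ζ (hsphere hζ),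
    circleAverage_circleAverage_comm hcont, hcauchy a (mem_closedBall_self hr)]
  refine Real.circleAverage_congr_sphere fun u hu ↦ ?_
  rw [abs_of_pos hρ] at hu
  exact circleAverage_eq_of_differentiableOn ((hF.comp (by fun_prop) fun ζ hζ ↦
    hmem ζ hζ u (sphere_subset_closedBall hu)).const_smul _) hr

theorem integral_Ioi_smul_deriv_add_mul_sq {g : ℂ → E} {b c : ℂ} (hc : c ≠ 0)
    (hg : ∀ r : ℝ, DifferentiableAt ℂ g (b + c * r ^ 2))
    (hint : IntegrableOn (fun r : ℝ ↦ r • deriv g (b + c * r ^ 2)) (Ioi 0))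
    (hlim : Tendsto (fun r : ℝ ↦ g (b + c * r ^ 2)) atTop (𝓝 0)) :
    ∫ r in Ioi (0 : ℝ), r • deriv g (b + c * r ^ 2) = -(2 * c)⁻¹ • g b := by
  have hderiv : ∀ r : ℝ, HasDerivAt (fun r : ℝ ↦ g (b + c * r ^ 2))
      ((2 * c) • r • deriv g (b + c * r ^ 2)) r := fun r ↦ by
    have hsq : HasDerivAt (fun r : ℝ ↦ (r : ℂ) ^ 2) (2 * r) r := by
      simpa using (hasDerivAt_pow 2 (r : ℂ)).comp_ofReal
    refine ((hg r).hasDerivAt.scomp r ((hsq.const_mul c).const_add b)).congr_deriv ?_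
    rw [← Complex.coe_smul, smul_smul]
    ring_nf
  have hftc := integral_Ioi_of_hasDerivAt_of_tendsto (hderiv 0).continuousAt.continuousWithinAt
    (fun r _ ↦ hderiv r) (hint.smul (2 * c)) hlim
  rw [integral_smul, Complex.ofReal_zero, zero_pow two_ne_zero, mul_zero, add_zero, zero_sub]
    at hftc
  rw [neg_smul, ← smul_neg, ← hftc, inv_smul_smul₀ (by simpa using hc)]

end MeanValue

/-! ### The reproducing property of the explicit Szegő kernel -/

theorem quad_eq_add (κ : ℝ) (l a ζ : ℂ) : quad κ l ζ =
    quad κ l a + κ * ‖ζ - a‖ ^ 2 + (2 * κ * conj a * (ζ - a) + l * (ζ ^ 2 - a ^ 2)).re := by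
  simp only [quad, ← Complex.normSq_eq_norm_sq, Complex.normSq_apply]
  simp [sq]
  ring

/-- The function `h` such that pairing `F(ζ, ·)` with the Szegő kernel at `(a, b)` along the line
over `ζ` evaluates `∂F/∂z₂` at `(ζ, b + i h(ζ))`. -/
noncomputable def szegoHeight (κ : ℝ) (l a ζ : ℂ) : ℂ :=
  2 * κ * conj ζ * (ζ - a) + l * (ζ ^ 2 - a ^ 2)

theorem conj_slice_szegoBracket (κ : ℝ) (l : ℂ) (w : ℂ × ℂ) (ζ : ℂ) (t : ℝ) :
    conj (slice (quad κ l) (fun z ↦ szegoBracket κ l z w) 0 (ζ, t)) =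
      Complex.I * (t - (w.2 + Complex.I * (szegoHeight κ l w.1 ζ - quad κ l ζ))) := by
  rw [slice, conj_szegoBracket]
  simp only [szegoBracket, szegoHeight, map_add, map_mul, Complex.conj_I, Complex.conj_ofReal,
    Complex.ofReal_zero, mul_zero, add_zero]
  rw [ofReal_quad]
  linear_combination
    -(2 * κ * w.1 * conj ζ + (l * w.1 ^ 2 + conj l * conj ζ ^ 2)) * Complex.I_sq

theorem integral_slice_mul_conj_modelSzego_fiber {κ : ℝ} (hκ : 0 ≤ κ) {l : ℂ} {w : ℂ × ℂ}
    (hw : w ∈ domainAbove (quad κ l)) {F : ℂ × ℂ → ℂ} (hF : F ∈ hardySpace (quad κ l))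
    {ε : ℝ} (hε : 0 < ε) (ζ : ℂ) :
    ∫ t : ℝ, slice (quad κ l) F ε (ζ, t) *
        conj (slice (quad κ l) (fun z ↦ modelSzego κ l z w) 0 (ζ, t)) =
      -(2 * κ * Complex.I / π) *
        deriv (fun v ↦ F (ζ, v)) (w.2 + Complex.I * ε + Complex.I * szegoHeight κ l w.1 ζ) := by
  set c := w.2 + Complex.I * (szegoHeight κ l w.1 ζ - quad κ l ζ) with hc_def
  set b := Complex.I * quad κ l ζ + Complex.I * ε with hb_def
  have hc : 0 < c.im := by
    have hre := (sub_pos.2 hw).trans_le (sub_le_re_slice_szegoBracket hκ (ζ, 0))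
    rw [← Complex.conj_re, conj_slice_szegoBracket] at hre
    simpa [hc_def] using hre
  have hkernel : ∀ t : ℝ, conj (slice (quad κ l) (fun z ↦ modelSzego κ l z w) 0 (ζ, t)) =
      -(κ / π ^ 2) * (((t : ℂ) - c) ^ 2)⁻¹ := fun t ↦ by
    simp only [slice_modelSzego, Complex.ofReal_zero, add_zero, map_mul, map_inv₀, map_pow,
      map_div₀, conj_slice_szegoBracket, Complex.conj_ofReal, mul_pow, Complex.I_sq, mul_inv]
    ring
  obtain ⟨M, hM⟩ := exists_norm_le_of_mem_hardySpace (continuous_quad κ l) hF ζ hε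
  have him : ∀ z : ℂ, 0 ≤ z.im → quad κ l ζ + ε ≤ (z + b).im := fun z hz ↦ by
    simpa [hb_def] using hz
  have hdiff : DifferentiableOn ℂ (fun z ↦ F (ζ, z + b)) {z | 0 ≤ z.im} :=
    hF.1.comp (by fun_prop) fun z hz ↦ (lt_add_of_pos_right _ hε).trans_le (him z hz)
  have hcauchy := integral_mul_inv_sub_sq hdiff.continuousOn
    (hdiff.mono fun z (hz : 0 < z.im) ↦ hz.le) (fun z hz ↦ hM _ (him z hz)) hc
  rw [deriv_comp_add_const (fun v ↦ F (ζ, v)) b c,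
    show c + b = w.2 + Complex.I * ε + Complex.I * szegoHeight κ l w.1 ζ by ring] at hcauchy
  simp only [hkernel, mul_left_comm _ (-(κ / π ^ 2) : ℂ)]
  rw [integral_const_mul]
  simp only [slice, add_assoc, ← hb_def] at hcauchy ⊢
  rw [hcauchy]
  have hπ : (π : ℂ) ≠ 0 := Complex.ofReal_ne_zero.2 Real.pi_ne_zero
  field_simp

theorem circleAverage_deriv_szegoHeight {κ : ℝ} (hκ : 0 ≤ κ) {l : ℂ} {w : ℂ × ℂ}
    (hw : w ∈ domainAbove (quad κ l)) {F : ℂ × ℂ → ℂ}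
    (hF : DifferentiableOn ℂ F (domainAbove (quad κ l))) {ε : ℝ} (hε : 0 ≤ ε) {r : ℝ}
    (hr : 0 ≤ r) :
    Real.circleAverage (fun ζ ↦ deriv (fun v ↦ F (ζ, v))
      (w.2 + Complex.I * ε + Complex.I * szegoHeight κ l w.1 ζ)) w.1 r =
      deriv (fun v ↦ F (w.1, v)) (w.2 + Complex.I * ε + Complex.I * (2 * κ : ℝ) * r ^ 2) := by
  -- On the circle `conj ζ * (ζ - a) = conj a * (ζ - a) + r ^ 2`, so the height agrees there with
  -- a holomorphic function of `ζ`.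
  set γ : ℂ → ℂ := fun ζ ↦ w.2 + Complex.I * ε + Complex.I *
    ((2 * κ * r ^ 2 : ℝ) + (2 * κ * conj w.1 * (ζ - w.1) + l * (ζ ^ 2 - w.1 ^ 2))) with hγ
  have hγ_center : γ w.1 = w.2 + Complex.I * ε + Complex.I * (2 * κ : ℝ) * r ^ 2 := by
    simp [hγ, mul_assoc]
  have hγ_sphere : ∀ ζ ∈ Metric.sphere w.1 |r|,
      w.2 + Complex.I * ε + Complex.I * szegoHeight κ l w.1 ζ = γ ζ := fun ζ hζ ↦ by
    have hsq : (ζ - w.1) * (conj ζ - conj w.1) = (r : ℂ) ^ 2 := by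
      rw [← map_sub, Complex.mul_conj, Complex.normSq_eq_norm_sq, mem_sphere_iff_norm.1 hζ, sq_abs]
      norm_cast
    simp only [hγ, szegoHeight]
    push_cast
    linear_combination Complex.I * 2 * κ * hsq
  have hγ_graph : ∀ ζ ∈ Metric.closedBall w.1 r, (ζ, γ ζ) ∈ domainAbove (quad κ l) :=
    fun ζ hζ ↦ by
    have hw' : quad κ l w.1 < w.2.im := hw
    have hsq : κ * ‖ζ - w.1‖ ^ 2 ≤ κ * r ^ 2 := by
      gcongr
      exact mem_closedBall_iff_norm.1 hζ
    have hnonneg : 0 ≤ κ * r ^ 2 := by positivity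
    rw [domainAbove, Set.mem_ofPred_eq, quad_eq_add κ l w.1 ζ]
    simp only [hγ, Complex.add_im, Complex.I_mul_im, Complex.ofReal_re, Complex.add_re]
    linarith
  rw [← hγ_center, ← circleAverage_deriv_snd (isOpen_domainAbove (continuous_quad κ l)) hF
    (by fun_prop) hr hγ_graph]
  exact Real.circleAverage_congr_sphere fun ζ hζ ↦ congrArg _ (hγ_sphere ζ hζ)

theorem integral_Ioi_smul_deriv_of_mem_hardySpace {p : ℂ → ℝ} (hp : Continuous p)
    {F : ℂ × ℂ → ℂ} (hF : F ∈ hardySpace p) {a b : ℂ} (hb : p a < b.im) {c : ℝ} (hc : 0 < c)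
    (hint : IntegrableOn (fun r : ℝ ↦ r • deriv (fun v ↦ F (a, v)) (b + Complex.I * c * r ^ 2))
      (Set.Ioi 0)) :
    ∫ r in Set.Ioi (0 : ℝ), r • deriv (fun v ↦ F (a, v)) (b + Complex.I * c * r ^ 2) =
      -(2 * (Complex.I * c))⁻¹ * F (a, b) := by
  have him : ∀ r : ℝ, (b + Complex.I * c * r ^ 2).im = b.im + c * r ^ 2 := fun r ↦ by
    rw [mul_assoc, ← Complex.ofReal_pow, ← Complex.ofReal_mul, Complex.add_im,
      Complex.I_mul_im, Complex.ofReal_re]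
  have hmem : ∀ r : ℝ, (a, b + Complex.I * c * r ^ 2) ∈ domainAbove p := fun r ↦ by
    rw [domainAbove, Set.mem_ofPred_eq, him]
    exact hb.trans_le (le_add_of_nonneg_right (by positivity))
  refine integral_Ioi_smul_deriv_add_mul_sq (g := fun v ↦ F (a, v)) (by simpa using hc.ne')
    (fun r ↦ ?_) hint (tendsto_zero_of_mem_hardySpace hp hF a ?_)
  · exact (hF.1.differentiableAt ((isOpen_domainAbove hp).mem_nhds (hmem r))).comp _
      (by fun_prop)
  · simp only [him]
    exact tendsto_atTop_add_const_left _ _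
      ((tendsto_pow_atTop two_ne_zero).const_mul_atTop hc)

theorem integral_slice_mul_conj_modelSzego {κ : ℝ} (hκ : 0 < κ) {l : ℂ} {w : ℂ × ℂ}
    (hw : w ∈ domainAbove (quad κ l)) {F : ℂ × ℂ → ℂ} (hF : F ∈ hardySpace (quad κ l))
    {ε : ℝ} (hε : 0 < ε) :
    ∫ q, slice (quad κ l) F ε q * conj (slice (quad κ l) (fun z ↦ modelSzego κ l z w) 0 q) =
      F (w.1, w.2 + Complex.I * ε) := by
  have hp := continuous_quad κ l
  have hκ₀ : (κ : ℂ) ≠ 0 := Complex.ofReal_ne_zero.2 hκ.ne'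
  have hπ : (π : ℂ) ≠ 0 := Complex.ofReal_ne_zero.2 Real.pi_ne_zero
  set b := w.2 + Complex.I * ε with hb_def
  have hb : quad κ l w.1 < b.im := by
    simpa [hb_def] using lt_add_of_lt_of_pos hw hε
  set D : ℂ → ℂ := fun ζ ↦ deriv (fun v ↦ F (ζ, v)) (b + Complex.I * szegoHeight κ l w.1 ζ)
  have hint : Integrable (fun q ↦ slice (quad κ l) F ε q *
      conj (slice (quad κ l) (fun z ↦ modelSzego κ l z w) 0 q)) (volume.prod volume) :=
    (memLp_slice hp hF hε).integrable_mul (memLp_slice_zero_modelSzego hκ hw).star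
  have hfiber := hint.integral_prod_left
  simp only [integral_slice_mul_conj_modelSzego_fiber hκ.le hw hF hε] at hfiber
  have hD : Integrable D := (integrable_const_mul_iff (IsUnit.mk0 _ (by simp [*])) D).1 hfiber
  have haverage : ∀ r ∈ Set.Ioi (0 : ℝ), r • Real.circleAverage D w.1 r =
      r • deriv (fun v ↦ F (w.1, v)) (b + Complex.I * (2 * κ : ℝ) * r ^ 2) := fun r hr ↦ by
    rw [circleAverage_deriv_szegoHeight hκ.le hw hF.1 hε.le (le_of_lt hr)]
  have hradial := integral_Ioi_smul_deriv_of_mem_hardySpace hp hF hb (mul_pos two_pos hκ)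
    ((integrableOn_smul_circleAverage hD w.1).congr_fun haverage measurableSet_Ioi)
  rw [Measure.volume_eq_prod, integral_prod _ hint]
  simp only [integral_slice_mul_conj_modelSzego_fiber hκ.le hw hF hε]
  rw [integral_const_mul, integral_eq_integral_smul_circleAverage hD w.1,
    setIntegral_congr_fun measurableSet_Ioi haverage, hradial, Complex.real_smul]
  push_cast
  field_simp

theorem tendsto_integral_mul_of_tendsto_eLpNorm {X ι : Type*} [MeasurableSpace X] {μ : Measure X}
    {𝓕 : Filter ι} {f : ι → X → ℂ} {g h : X → ℂ} (hf : ∀ᶠ i in 𝓕, MemLp (f i) 2 μ)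
    (hg : MemLp g 2 μ) (hfg : Tendsto (fun i ↦ eLpNorm (fun x ↦ f i x - g x) 2 μ) 𝓕 (𝓝 0))
    (hh : MemLp h 2 μ) :
    Tendsto (fun i ↦ ∫ x, f i x * h x ∂μ) 𝓕 (𝓝 (∫ x, g x * h x ∂μ)) := by
  refine tendsto_integral_of_L1' _ (hg.integrable_mul hh).aestronglyMeasurable
    (hf.mono fun i hi ↦ hi.integrable_mul hh) ?_
  have hlim := ENNReal.Tendsto.mul_const hfg (b := eLpNorm h 2 μ) (Or.inr hh.2.ne)
  rw [zero_mul] at hlim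
  refine tendsto_of_tendsto_of_tendsto_of_le_of_le' tendsto_const_nhds hlim
    (Eventually.of_forall fun _ ↦ bot_le) (hf.mono fun i hi ↦ ?_)
  have hholder := eLpNorm_smul_le_mul_eLpNorm (p := 2) (q := 2) (r := 1) hh.1 (hi.1.sub hg.1)
  refine hholder.trans_eq' (congrArg (eLpNorm · 1 μ) (funext fun x ↦ ?_))
  simp [sub_mul]

theorem eq_integral_isBoundaryValue_mul_conj {κ : ℝ} (hκ : 0 < κ) {l : ℂ} {w : ℂ × ℂ}
    (hw : w ∈ domainAbove (quad κ l)) {F : ℂ × ℂ → ℂ} (hF : F ∈ hardySpace (quad κ l))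
    {f : ℂ × ℝ → ℂ} (hf : IsBoundaryValue (quad κ l) F f) :
    F w = ∫ q, f q * conj (slice (quad κ l) (fun z ↦ modelSzego κ l z w) 0 q) := by
  have hp := continuous_quad κ l
  have heval : Tendsto (fun ε : ℝ ↦ F (w.1, w.2 + Complex.I * ε)) (𝓝[>] 0) (𝓝 (F w)) := by
    have hray : Tendsto (fun ε : ℝ ↦ (w.1, w.2 + Complex.I * ε)) (𝓝[>] 0) (𝓝 w) := by
      have hcont : Continuous fun ε : ℝ ↦ (w.1, w.2 + Complex.I * ε) := by fun_prop
      simpa using (hcont.tendsto 0).mono_left nhdsWithin_le_nhds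
    exact (hF.1.continuousOn.continuousAt ((isOpen_domainAbove hp).mem_nhds hw)).tendsto.comp hray
  have hpairing := tendsto_integral_mul_of_tendsto_eLpNorm
    (eventually_mem_nhdsWithin.mono fun ε hε ↦ memLp_slice hp hF hε) hf.1 hf.2
    (memLp_slice_zero_modelSzego hκ hw).star
  refine tendsto_nhds_unique heval (hpairing.congr' ?_)
  filter_upwards [self_mem_nhdsWithin] with ε hε
  exact integral_slice_mul_conj_modelSzego hκ hw hF hε

theorem isSzegoKernel_modelSzego {κ : ℝ} (hκ : 0 < κ) (l : ℂ) :
    IsSzegoKernel (quad κ l) (modelSzego κ l) := by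
  refine fun w hw ↦ ⟨modelSzego_mem_hardySpace hκ hw, _, isBoundaryValue_modelSzego hκ hw,
    fun F hF ↦ ?_⟩
  obtain ⟨f, hf⟩ := exists_isBoundaryValue (continuous_quad κ l) hF
  exact ⟨f, hf, eq_integral_isBoundaryValue_mul_conj hκ hw hF hf⟩

/-! ### Uniqueness of the Szegő kernel -/

theorem IsSzegoKernel.apply_eq_conj {p : ℂ → ℝ} (hp : Continuous p) {S S' : ℂ × ℂ → ℂ × ℂ → ℂ}
    (hS : IsSzegoKernel p S) (hS' : IsSzegoKernel p S') {z w : ℂ × ℂ} (hz : z ∈ domainAbove p)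
    (hw : w ∈ domainAbove p) : S z w = conj (S' w z) := by
  obtain ⟨hmem, s, hs, hrep⟩ := hS w hw
  obtain ⟨hmem', s', hs', hrep'⟩ := hS' z hz
  obtain ⟨f, hf, hfz⟩ := hrep' _ hmem
  obtain ⟨g, hg, hgw⟩ := hrep _ hmem'
  rw [hfz, hgw, ← integral_conj]
  refine integral_congr_ae ?_
  filter_upwards [hf.ae_eq hp hmem.1.continuousOn hs, hg.ae_eq hp hmem'.1.continuousOn hs']
    with q hfs hgs
  rw [hfs, hgs, map_mul, Complex.conj_conj, mul_comm]

theorem IsSzegoKernel.unique {p : ℂ → ℝ} (hp : Continuous p) {S S' : ℂ × ℂ → ℂ × ℂ → ℂ}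
    (hS : IsSzegoKernel p S) (hS' : IsSzegoKernel p S') {z w : ℂ × ℂ} (hz : z ∈ domainAbove p)
    (hw : w ∈ domainAbove p) : S z w = S' z w := by
  rw [hS.apply_eq_conj hp hS hz hw, ← hS'.apply_eq_conj hp hS hz hw]

/-! ### The Szegő kernel as an integral of Bergman kernels -/

theorem tendsto_pow_mul_cexp_neg_mul_atTop {c : ℂ} (hc : 0 < c.re) (n : ℕ) :
    Tendsto (fun τ : ℝ ↦ (τ : ℂ) ^ n * Complex.exp (-c * τ)) atTop (𝓝 0) := by
  rw [tendsto_zero_iff_norm_tendsto_zero]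
  refine (tendsto_rpow_mul_exp_neg_mul_atTop_nhds_zero n c.re hc).congr' ?_
  filter_upwards [eventually_gt_atTop 0] with τ hτ
  simp [Complex.norm_exp, abs_of_pos hτ]

theorem integrableOn_mul_cexp_neg_mul {c : ℂ} (hc : 0 < c.re) :
    IntegrableOn (fun τ : ℝ ↦ (τ : ℂ) * Complex.exp (-c * τ)) (Set.Ioi 0) := by
  refine (integrableOn_rpow_mul_exp_neg_mul_rpow (s := 1) (p := 1) (by norm_num) one_pos
    hc).mono' (by fun_prop) ?_
  filter_upwards [ae_restrict_mem measurableSet_Ioi] with τ hτ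
  simp [Complex.norm_exp, abs_of_pos (Set.mem_Ioi.1 hτ)]

theorem integral_mul_cexp_neg_mul {c : ℂ} (hc : 0 < c.re) :
    ∫ τ in Set.Ioi (0 : ℝ), (τ : ℂ) * Complex.exp (-c * τ) = (c ^ 2)⁻¹ := by
  have hc₀ : c ≠ 0 := fun h ↦ by simp [h] at hc
  have hderiv : ∀ τ : ℝ, HasDerivAt
      (fun τ : ℝ ↦ -(τ * Complex.exp (-c * τ)) / c - Complex.exp (-c * τ) / c ^ 2)
      ((τ : ℂ) * Complex.exp (-c * τ)) τ := fun τ ↦ by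
    have hid : HasDerivAt (fun τ : ℝ ↦ (τ : ℂ)) 1 τ := Complex.ofRealCLM.hasDerivAt
    have hexp := (hid.const_mul (-c)).cexp
    refine (((hid.fun_mul hexp).fun_neg.div_const c).fun_sub
      (hexp.div_const (c ^ 2))).congr_deriv ?_
    field_simp
    ring
  have hlim := ((tendsto_pow_mul_cexp_neg_mul_atTop hc 1).neg.div_const c).sub
    ((tendsto_pow_mul_cexp_neg_mul_atTop hc 0).div_const (c ^ 2))
  simp only [pow_zero, pow_one, one_mul] at hlim
  rw [integral_Ioi_of_hasDerivAt_of_tendsto (hderiv 0).continuousAt.continuousWithinAt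
    (fun τ _ ↦ hderiv τ) (integrableOn_mul_cexp_neg_mul hc) hlim]
  simp

theorem modelBergman_mul_cexp (κ : ℝ) (l : ℂ) (z w : ℂ × ℂ) (τ : ℝ) :
    modelBergman κ l τ z.1 w.1 * Complex.exp (-2 * π * Complex.I * τ * (conj w.2 - z.2)) =
      4 * κ * (τ * Complex.exp (-(2 * π * szegoBracket κ l z w) * τ)) := by
  rw [modelBergman, mul_assoc, ← Complex.exp_add, szegoBracket]
  ring_nf

section Integral

variable {κ : ℝ} {l : ℂ} {z w : ℂ × ℂ}

theorem re_two_pi_mul_szegoBracket_pos (hκ : 0 ≤ κ) (hz : z ∈ domainAbove (quad κ l))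
    (hw : w ∈ domainAbove (quad κ l)) : 0 < (2 * π * szegoBracket κ l z w).re := by
  have hre : 0 < (szegoBracket κ l z w).re := by
    rw [re_szegoBracket]
    exact add_pos_of_pos_of_nonneg (add_pos (sub_pos.2 hz) (sub_pos.2 hw)) (by positivity)
  rw [← Complex.ofReal_ofNat, ← Complex.ofReal_mul, Complex.re_ofReal_mul]
  positivity

theorem integrableOn_modelBergman_mul_cexp (hκ : 0 ≤ κ) (hz : z ∈ domainAbove (quad κ l))
    (hw : w ∈ domainAbove (quad κ l)) :
    IntegrableOn (fun τ : ℝ ↦ modelBergman κ l τ z.1 w.1 *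
      Complex.exp (-2 * π * Complex.I * τ * (conj w.2 - z.2))) (Set.Ioi 0) := by
  simp only [modelBergman_mul_cexp]
  exact (integrableOn_mul_cexp_neg_mul (re_two_pi_mul_szegoBracket_pos hκ hz hw)).const_mul _

theorem modelSzego_eq_integral (hκ : 0 ≤ κ) (hz : z ∈ domainAbove (quad κ l))
    (hw : w ∈ domainAbove (quad κ l)) :
    modelSzego κ l z w = ∫ τ in Set.Ioi (0 : ℝ), modelBergman κ l τ z.1 w.1 *
      Complex.exp (-2 * π * Complex.I * τ * (conj w.2 - z.2)) := by
  have hπ : (π : ℂ) ≠ 0 := Complex.ofReal_ne_zero.2 Real.pi_ne_zero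
  simp only [modelBergman_mul_cexp]
  rw [integral_const_mul,
    integral_mul_cexp_neg_mul (re_two_pi_mul_szegoBracket_pos hκ hz hw), modelSzego_eq]
  field_simp
  norm_num

end Integral

end SzegoBergman

theorem mainTheorem5 (κ : ℝ) (hκ : 0 < κ) (l : ℂ) :
    (∃ K : ℝ → ℂ → ℂ → ℂ, ∀ τ : ℝ, 0 < τ →
      SzegoBergman.IsBergmanKernel (SzegoBergman.modelWeight τ κ l) (K τ)) ∧
    (∃ S : ℂ × ℂ → ℂ × ℂ → ℂ, SzegoBergman.IsSzegoKernel (SzegoBergman.quad κ l) S) ∧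
    ∀ K : ℝ → ℂ → ℂ → ℂ,
      (∀ τ : ℝ, 0 < τ → SzegoBergman.IsBergmanKernel (SzegoBergman.modelWeight τ κ l) (K τ)) →
    ∀ S : ℂ × ℂ → ℂ × ℂ → ℂ, SzegoBergman.IsSzegoKernel (SzegoBergman.quad κ l) S →
      (∀ τ : ℝ, 0 < τ → ∀ z w : ℂ,
        K τ z w = 4 * τ * κ * Complex.exp
          (2 * π * τ * (l * z ^ 2 + conj l * conj w ^ 2) + 4 * π * τ * κ * z * conj w)) ∧
      ∀ z ∈ SzegoBergman.modelDomain κ l, ∀ w ∈ SzegoBergman.modelDomain κ l,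
        IntegrableOn (fun τ : ℝ => K τ z.1 w.1 *
          Complex.exp (-2 * π * Complex.I * τ * (conj w.2 - z.2))) (Set.Ioi 0) volume ∧
        S z w = ∫ τ in Set.Ioi (0 : ℝ), K τ z.1 w.1 *
          Complex.exp (-2 * π * Complex.I * τ * (conj w.2 - z.2)) ∧
        S z w = κ / π ^ 2 * (Complex.I * (conj w.2 - z.2) - 2 * κ * z.1 * conj w.1
          - (l * z.1 ^ 2 + conj l * conj w.1 ^ 2)) ^ (-2 : ℤ) := by
  have hK₀ := fun τ (hτ : 0 < τ) ↦ SzegoBergman.isBergmanKernel_modelBergman hκ l hτ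
  have hS₀ := SzegoBergman.isSzegoKernel_modelSzego hκ l
  refine ⟨⟨_, hK₀⟩, ⟨_, hS₀⟩, fun K hK S hS ↦ ?_⟩
  have hK_eq : ∀ τ : ℝ, 0 < τ → K τ = SzegoBergman.modelBergman κ l τ := fun τ hτ ↦
    (hK τ hτ).unique (hK₀ τ hτ)
  refine ⟨fun τ hτ z w ↦ congrFun₂ (hK_eq τ hτ) z w, fun z hz w hw ↦ ?_⟩
  have hS_eq : S z w = SzegoBergman.modelSzego κ l z w :=
    hS.unique (SzegoBergman.continuous_quad κ l) hS₀ hz hw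
  have hintegrand : ∀ τ ∈ Set.Ioi (0 : ℝ), SzegoBergman.modelBergman κ l τ z.1 w.1 *
      Complex.exp (-2 * π * Complex.I * τ * (conj w.2 - z.2)) =
      K τ z.1 w.1 * Complex.exp (-2 * π * Complex.I * τ * (conj w.2 - z.2)) := fun τ hτ ↦ by
    rw [hK_eq τ hτ]
  refine ⟨(SzegoBergman.integrableOn_modelBergman_mul_cexp hκ.le hz hw).congr_fun hintegrand
    measurableSet_Ioi, ?_, hS_eq⟩
  rw [hS_eq, SzegoBergman.modelSzego_eq_integral hκ.le hz hw]
  exact setIntegral_congr_fun measurableSet_Ioi hintegrand
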